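/- For $x\in[0,1)$ let $K(x)=\int_0^{\pi/2}\frac{d\varphi}{\sqrt{1-x^2\sin^2\varphi}}$ be the complete elliptic integral of the first kind, and for $x\in(0,1)$ let $G(x)=K(\sqrt{1-x^2})/K(x)$. For $a>1$ let $\mathbf{E}_a=\{x+iy\in\mathbb{C}:\ x^2/a^2+y^2<1\}$. Then the following hold. (1) For every $a>1$ there is a unique $k=k(a)\in(0,1)$ with $G(k)=\frac{2}{\pi}\sinh^{-1}\!\left(\frac{2a}{a^2-1}\right)$. (2) The number $1-\frac{1}{4k^2}\Big((1+k^2)-\big(\frac{\pi}{2K(k)}\big)^2\Big)^2$ is positive for every $k\in(0,1)$. The function $$g(k)=\left(1-\frac{1}{4k^2}\Big((1+k^2)-\Big(\frac{\pi}{2K(k)}\Big)^2\Big)^2\right)^{-1/2}\quad(0<k<1),\qquad g(0)=1,$$ is continuous and strictly increasing on $[0,1)$, and $\lim_{k\to1^-}g(k)=\infty$. (3) For every integer $n\ge1$ there is a unique $k_n\in[0,1)$ with $g(k_n)=n$, and for every integer $n\ge2$ there is a unique $a_n>1$ with $g(k(a_n))=n$. (4) For every $a\in(1,\infty)\setminus\{a_n:\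 n\ge2\}$ the following non-degeneracy condition holds. The point $0$ is a critical point of the Robin function $\mathcal{R}(z)=\lim_{w\to z}\big(G_{\mathbf{E}_a}(z,w)-\log|z-w|\big)$ of $\mathbf{E}_a$, where $G_{\mathbf{E}_a}$ is the Green function ($\Delta_zG_{\mathbf{E}_a}(z,w)=2\pi\delta_w(z)$ in $\mathbf{E}_a$, and $G_{\mathbf{E}_a}(z,w)=0$ for $z\in\partial\mathbf{E}_a$). There is a conformal mapping $\Phi$ of $\mathbf{E}_a$ onto the open unit disc with $\Phi(0)=0$, and every such $\Phi$ satisfies $$\left|\frac{\Phi^{(3)}(0)}{\Phi'(0)^3}\right|\notin\Big\{2\sqrt{1-\tfrac1{n^2}}:\ n=1,2,3,\dots\Big\}\cup\{2\}.$$ -/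

import Mathlib

open Real Set Filter Topology

noncomputable section

namespace VortexEllipse

/-- The complete Legendre elliptic integral of the first kind, as a function of the modulus
`0 ≤ x < 1`. -/
def ellipticK (x : ℝ) : ℝ :=
  ∫ φ in (0 : ℝ)..(π / 2), 1 / √(1 - x ^ 2 * sin φ ^ 2)

/-- The quotient `K(√(1 - x²)) / K(x)` of complementary elliptic integrals, for `0 < x < 1`. -/
def quotientG (x : ℝ) : ℝ :=
  ellipticK √(1 - x ^ 2) / ellipticK x

/-- `k` solves the equation that defines the elliptic modulus of the ellipse with semi-axes
`a` and `1`. -/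
def IsModulus (a k : ℝ) : Prop :=
  k ∈ Ioo (0 : ℝ) 1 ∧ quotientG k = 2 / π * arsinh (2 * a / (a ^ 2 - 1))

/-- The elliptic modulus `k(a)`: the solution `k ∈ (0, 1)` of
`G(k) = (2 / π) arsinh (2a / (a² - 1))`. The theorem asserts that for `a > 1` such a solution
exists and is unique. -/
def modulus (a : ℝ) : ℝ :=
  Classical.epsilon (IsModulus a)

/-- The quantity whose power `-1/2` is `g(k)`, for `0 < k < 1`. -/
def radicand (k : ℝ) : ℝ :=
  1 - 1 / (4 * k ^ 2) * ((1 + k ^ 2) - (π / (2 * ellipticK k)) ^ 2) ^ 2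

/-- The function `g` on `[0, 1)`. The formula has a removable singularity at `k = 0`, where the
value is `1` (that this is the continuous extension is asserted in the theorem). -/
def g (k : ℝ) : ℝ :=
  if k = 0 then 1 else radicand k ^ (-(1 / 2) : ℝ)

/-- The open region bounded by the ellipse with semi-axes `a` and `1`. -/
def ellipse (a : ℝ) : Set ℂ :=
  {z | z.re ^ 2 / a ^ 2 + z.im ^ 2 < 1}

/-- `Φ` is a conformal mapping of the open set `D` onto the open unit disc. -/
def IsConformalOntoDisc (D : Set ℂ) (Φ : ℂ → ℂ) : Prop :=
  DifferentiableOn ℂ Φ D ∧ BijOn Φ D (Metric.ball 0 1)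

/-- `H` is the regular part of the Green function `log |z - w| + H z w` of the bounded domain `D`
(normalised by `Δ_z = 2π δ_w`): it is harmonic in `z`, and the Green function vanishes on the
boundary. -/
def IsGreenRegularPart (D : Set ℂ) (H : ℂ → ℂ → ℝ) : Prop :=
  ∀ w ∈ D, InnerProductSpace.HarmonicOnNhd (fun z => H z w) D ∧
    ∀ ζ ∈ frontier D, Tendsto (fun z => Real.log ‖z - w‖ + H z w) (𝓝[D] ζ) (𝓝 0)

/-- `R` is the Robin function of `D`: the diagonal of the regular part of the Green function.
For a bounded open set `D` there is at most one such function on `D`. -/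
def IsRobinFunction (D : Set ℂ) (R : ℂ → ℝ) : Prop :=
  ∃ H, IsGreenRegularPart D H ∧ ∀ z ∈ D, R z = H z z

/-- `ξ` is a critical point of the Robin function of `D`. -/
def IsRobinCritical (D : Set ℂ) (ξ : ℂ) : Prop :=
  ξ ∈ D ∧ ∃ R, IsRobinFunction D R ∧ HasFDerivAt R (0 : ℂ →L[ℝ] ℝ) ξ

/-- The exceptional values `2 √(1 - 1/n²)`, `n = 1, 2, 3, …`, together with the value `2` that
corresponds to `n = ∞`. -/
def exceptionalValues : Set ℝ :=
  {x | (∃ n : ℕ, 1 ≤ n ∧ x = 2 * √(1 - 1 / (n : ℝ) ^ 2)) ∨ x = 2}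

/-- The non-degeneracy condition for `D` at the point `ξ`: the point is critical for the Robin
function, and for the conformal mapping `Φ` of `D` onto the unit disc that sends `ξ` to `0` (it
exists, and is unique up to a rotation) the modulus of `Φ''' / (Φ')³` at `ξ` is not an exceptional
value. -/
def NonDegenerate (D : Set ℂ) (ξ : ℂ) : Prop :=
  IsRobinCritical D ξ ∧
  (∃ Φ, IsConformalOntoDisc D Φ ∧ Φ ξ = 0) ∧
  ∀ Φ, IsConformalOntoDisc D Φ → Φ ξ = 0 →
    ‖iteratedDeriv 3 Φ ξ / deriv Φ ξ ^ 3‖ ∉ exceptionalValues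

end VortexEllipse

end

noncomputable section

namespace VortexEllipse

/-! ### The complete elliptic integral -/

/-! The real-variable part rests on monotonicity. `ellipticK` increases continuously from π/2 to ∞,
so `quotientG` decreases continuously onto (0, ∞), and a ↦ k(a) is a bijection of (1, ∞) onto (0,
1). Put h(k) = ((1 + k²) - (π/(2K))²)/(2k), which is `halfRatio`; then g = (1 - h²)^(-1/2). The
bounds 1 - k² ≤ (π/(2K))² ≤ 1 give 0 < h ≤ k, and they also make h increasing. Hence g increases
continuously from 1 to ∞.

For the ellipse with foci ±c, c² = a² - 1, the map onto the disc is √k sn((2K/π) arcsin(z/c)), but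
no theory of sn is used. The map is built as a product. In the coordinate z = c sin u, repeated
Schwarz reflection of the zero u = 0 in the lines Im u = ±½|log r|, r = (a - 1)/(a + 1), predicts
zeros at even and poles at odd multiples of i|log r|. On the boundary ellipse the moduli of the
resulting factors telescope, so the product has constant modulus there
(`norm_thetaQuotientPartial`). A holomorphic function with unimodular boundary values and one simple
zero is a bijection onto the disc (`bijOn_ball_of_unimodular_frontier`).

With σ = Φ(c), the quotient of Φ'²(c² - z²) by (σ² - Φ²)(1 - σ²Φ²) extends holomorphically over the
foci and is real on the boundary, hence is a real constant r, unrelated to the r above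
(`exists_ode`). Integrating this equation along [0, c] gives K(σ²) = √r π/2, and along [0, i] it
gives half of the complementary integral; the ratio shows k(a) = σ² (`isModulus_focalValue`).
Differentiating the equation at 0 gives Φ'''(0)/Φ'(0)³ = -2h(k(a)) (`norm_third_deriv_div`). The
modulus 2h equals 2√(1 - 1/n²) exactly when g(k(a)) = n, and it is never 2. By the Schwarz lemma
every other Φ differs by a rotation, which does not change this modulus (`conformal_unique`).

The Robin function is log|Φ'| - log|1 - |Φ|²|. It is critical at 0 because Φ is odd. -/

lemma one_sub_sq_mul_sin_sq_ge {x : ℝ} (φ : ℝ) : 1 - x ^ 2 ≤ 1 - x ^ 2 * sin φ ^ 2 := by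
  nlinarith [sin_sq_le_one φ, sq_nonneg x]

lemma one_sub_sq_pos {x : ℝ} (h0 : 0 ≤ x) (h1 : x < 1) : 0 < 1 - x ^ 2 := by nlinarith

lemma ellipticK_integrand_continuous {x : ℝ} (h0 : 0 ≤ x) (h1 : x < 1) :
    Continuous fun φ : ℝ => 1 / √(1 - x ^ 2 * sin φ ^ 2) := by
  refine continuous_const.div (by fun_prop) fun φ => ?_
  exact (sqrt_pos.2 ((one_sub_sq_pos h0 h1).trans_le (one_sub_sq_mul_sin_sq_ge φ))).ne'

lemma ellipticK_zero : ellipticK 0 = π / 2 := by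
  simp [ellipticK]

lemma ellipticK_strictMonoOn : StrictMonoOn ellipticK (Ico 0 1) := by
  intro x hx y hy hxy
  have hxy2 : x ^ 2 < y ^ 2 := by nlinarith [hx.1]
  have hpos : ∀ φ : ℝ, 0 < 1 - y ^ 2 * sin φ ^ 2 := fun φ =>
    (one_sub_sq_pos hy.1 hy.2).trans_le (one_sub_sq_mul_sin_sq_ge φ)
  refine intervalIntegral.integral_lt_integral_of_continuousOn_of_le_of_exists_lt
    (by positivity) (ellipticK_integrand_continuous hx.1 hx.2).continuousOn
    (ellipticK_integrand_continuous hy.1 hy.2).continuousOn (fun φ _ => ?_)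
    ⟨π / 2, ⟨by positivity, le_rfl⟩, ?_⟩
  · refine one_div_le_one_div_of_le (sqrt_pos.2 (hpos φ)) (sqrt_le_sqrt ?_)
    nlinarith [sq_nonneg (sin φ)]
  · refine one_div_lt_one_div_of_lt (sqrt_pos.2 (hpos _)) (sqrt_lt_sqrt (hpos _).le ?_)
    simpa using hxy2

lemma pi_div_two_le_ellipticK {x : ℝ} (hx : x ∈ Ico (0 : ℝ) 1) : π / 2 ≤ ellipticK x := by
  rw [← ellipticK_zero]
  exact ellipticK_strictMonoOn.monotoneOn ⟨le_rfl, one_pos⟩ hx hx.1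

lemma ellipticK_pos {x : ℝ} (hx : x ∈ Ico (0 : ℝ) 1) : 0 < ellipticK x :=
  pi_div_two_pos.trans_le (pi_div_two_le_ellipticK hx)

lemma ellipticK_le {x : ℝ} (hx : x ∈ Ico (0 : ℝ) 1) : ellipticK x ≤ π / 2 / √(1 - x ^ 2) := by
  have h : ellipticK x ≤ ∫ _ in (0 : ℝ)..(π / 2), 1 / √(1 - x ^ 2) := by
    refine intervalIntegral.integral_mono_on (by positivity)
      ((ellipticK_integrand_continuous hx.1 hx.2).intervalIntegrable _ _) (by simp) fun φ _ => ?_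
    exact one_div_le_one_div_of_le (sqrt_pos.2 (one_sub_sq_pos hx.1 hx.2))
      (sqrt_le_sqrt (one_sub_sq_mul_sin_sq_ge φ))
  rw [intervalIntegral.integral_const] at h
  simpa [div_eq_mul_inv] using h

lemma ellipticK_continuousOn : ContinuousOn ellipticK (Ico 0 1) := by
  intro x hx
  obtain ⟨s, hxs, hs⟩ := exists_between hx.2
  have hs0 : 0 ≤ s := hx.1.trans hxs.le
  refine intervalIntegral.continuousWithinAt_of_dominated_interval
    (bound := fun _ => 1 / √(1 - s ^ 2)) ?_ ?_ (by simp) ?_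
  · filter_upwards [self_mem_nhdsWithin] with y hy
    exact (ellipticK_integrand_continuous hy.1 hy.2).aestronglyMeasurable
  · filter_upwards [self_mem_nhdsWithin, mem_nhdsWithin_of_mem_nhds (Iio_mem_nhds hxs)] with y hy hys
    refine Eventually.of_forall fun φ _ => ?_
    rw [Real.norm_of_nonneg (by positivity)]
    refine one_div_le_one_div_of_le (sqrt_pos.2 (one_sub_sq_pos hs0 hs)) (sqrt_le_sqrt ?_)
    refine le_trans ?_ (one_sub_sq_mul_sin_sq_ge φ)
    have : y ^ 2 ≤ s ^ 2 := pow_le_pow_left₀ hy.1 (le_of_lt hys) 2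
    linarith
  · refine Eventually.of_forall fun φ _ => ContinuousAt.continuousWithinAt ?_
    refine continuousAt_const.div (by fun_prop) ?_
    exact (sqrt_pos.2 ((one_sub_sq_pos hx.1 hx.2).trans_le (one_sub_sq_mul_sin_sq_ge φ))).ne'

/-- With t = π/2 - φ, cos φ ≤ t gives 1 - x² sin² φ = ε² + x² cos² φ ≤ (ε + t)². The integrand
therefore dominates 1/(ε + t), whose integral diverges logarithmically as ε → 0. -/
lemma log_le_ellipticK {x : ℝ} (hx : x ∈ Ico (0 : ℝ) 1) :
    Real.log (1 / √(1 - x ^ 2)) ≤ ellipticK x := by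
  set ε := √(1 - x ^ 2) with hε
  have hε0 : 0 < ε := sqrt_pos.2 (one_sub_sq_pos hx.1 hx.2)
  have hε2 : ε ^ 2 = 1 - x ^ 2 := sq_sqrt (one_sub_sq_pos hx.1 hx.2).le
  have h1 : ∫ φ in (0 : ℝ)..(π / 2), (ε + π / 2 - φ)⁻¹ = Real.log ((ε + π / 2) / ε) := by
    rw [intervalIntegral.integral_comp_sub_left (fun t => t⁻¹), integral_inv_of_pos] <;>
      simp <;> positivity
  have hcont : ContinuousOn (fun φ : ℝ => (ε + π / 2 - φ)⁻¹) (uIcc 0 (π / 2)) := by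
    refine ContinuousOn.inv₀ (by fun_prop) fun φ hφ => ?_
    rw [uIcc_of_le (by positivity)] at hφ
    linarith [hφ.2]
  have h2 : ∫ φ in (0 : ℝ)..(π / 2), (ε + π / 2 - φ)⁻¹ ≤ ellipticK x := by
    refine intervalIntegral.integral_mono_on (by positivity) hcont.intervalIntegrable
      ((ellipticK_integrand_continuous hx.1 hx.2).intervalIntegrable _ _) fun φ hφ => ?_
    rw [← one_div]
    have hpos := (one_sub_sq_pos hx.1 hx.2).trans_le (one_sub_sq_mul_sin_sq_ge (x := x) φ)
    refine one_div_le_one_div_of_le (sqrt_pos.2 hpos) ?_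
    have ht : 0 ≤ π / 2 - φ := by linarith [hφ.2]
    rw [sqrt_le_left (by linarith)]
    have hc : cos φ ≤ π / 2 - φ := by
      rw [← sin_pi_div_two_sub]; exact sin_le ht
    have hc0 : 0 ≤ cos φ := cos_nonneg_of_mem_Icc ⟨by linarith [hφ.1, pi_pos], hφ.2⟩
    have hc2 : cos φ ^ 2 ≤ (π / 2 - φ) ^ 2 := pow_le_pow_left₀ hc0 hc 2
    have hx2 : x ^ 2 ≤ 1 := by nlinarith [hx.1, hx.2]
    have := sin_sq_add_cos_sq φ
    nlinarith [mul_nonneg hε0.le ht, sq_nonneg (cos φ), mul_le_mul_of_nonneg_right hx2 (sq_nonneg (cos φ))]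
  refine le_trans ?_ (h1 ▸ h2)
  refine log_le_log (by positivity) ?_
  gcongr
  linarith [pi_gt_three]

lemma tendsto_sqrt_one_sub_sq : Tendsto (fun x : ℝ => √(1 - x ^ 2)) (𝓝[<] 1) (𝓝[>] 0) := by
  refine tendsto_nhdsWithin_iff.2 ⟨?_, ?_⟩
  · have : Tendsto (fun x : ℝ => √(1 - x ^ 2)) (𝓝 1) (𝓝 (√(1 - 1 ^ 2))) :=
      Continuous.tendsto (by fun_prop) 1
    simpa using this.mono_left nhdsWithin_le_nhds
  · filter_upwards [Ioo_mem_nhdsLT (zero_lt_one' ℝ)] with x hx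
    exact sqrt_pos.2 (one_sub_sq_pos hx.1.le hx.2)

lemma tendsto_ellipticK : Tendsto ellipticK (𝓝[<] 1) atTop := by
  have h : Tendsto (fun x : ℝ => Real.log (1 / √(1 - x ^ 2))) (𝓝[<] 1) atTop := by
    simp_rw [one_div]
    exact tendsto_log_atTop.comp (tendsto_inv_nhdsGT_zero.comp tendsto_sqrt_one_sub_sq)
  refine tendsto_atTop_mono' _ ?_ h
  filter_upwards [Ioo_mem_nhdsLT (zero_lt_one' ℝ)] with x hx
  exact log_le_ellipticK ⟨hx.1.le, hx.2⟩

/-! ### The quotient of complementary integrals -/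

lemma sqrt_one_sub_sq_mem {x : ℝ} (hx : x ∈ Ioo (0 : ℝ) 1) : √(1 - x ^ 2) ∈ Ioo (0 : ℝ) 1 := by
  refine ⟨sqrt_pos.2 (one_sub_sq_pos hx.1.le hx.2), ?_⟩
  rw [sqrt_lt' one_pos]
  nlinarith [hx.1]

lemma quotientG_strictAntiOn : StrictAntiOn quotientG (Ioo 0 1) := by
  intro x hx y hy hxy
  have hx' := sqrt_one_sub_sq_mem hx
  have hy' := sqrt_one_sub_sq_mem hy
  have h1 : √(1 - y ^ 2) < √(1 - x ^ 2) :=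
    sqrt_lt_sqrt (one_sub_sq_pos hy.1.le hy.2).le (by nlinarith [hx.1])
  have h2 := ellipticK_strictMonoOn (Ioo_subset_Ico_self hy') (Ioo_subset_Ico_self hx') h1
  have h3 := ellipticK_strictMonoOn (Ioo_subset_Ico_self hx) (Ioo_subset_Ico_self hy) hxy
  have := ellipticK_pos (Ioo_subset_Ico_self hx)
  exact div_lt_div₀ h2 h3.le (ellipticK_pos (Ioo_subset_Ico_self hx')).le this

lemma quotientG_continuousOn : ContinuousOn quotientG (Ioo 0 1) := by
  refine ContinuousOn.div ?_ (ellipticK_continuousOn.mono Ioo_subset_Ico_self)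
    fun x hx => (ellipticK_pos (Ioo_subset_Ico_self hx)).ne'
  exact ellipticK_continuousOn.comp (by fun_prop)
    fun x hx => Ioo_subset_Ico_self (sqrt_one_sub_sq_mem hx)

lemma exists_quotientG_eq {y : ℝ} (hy : 0 < y) : ∃ k ∈ Ioo (0 : ℝ) 1, quotientG k = y := by
  have hlow : ∃ k ∈ Ioo (0 : ℝ) 1, quotientG k < y := by
    -- For k ≥ 1/2 the numerator of `quotientG k` is at most the fixed number K(√(1 - 1/4)), while
    -- the denominator tends to infinity. Large values are found below by exchanging k with its
    -- complementary modulus.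
    have h1 := tendsto_ellipticK.eventually_gt_atTop (ellipticK √(1 - (1 / 2) ^ 2) / y)
    obtain ⟨k, hk, hk1, hk2⟩ := (h1.and (Ioo_mem_nhdsLT (by norm_num : (1 / 2 : ℝ) < 1))).exists
    have hk0 : k ∈ Ioo (0 : ℝ) 1 := ⟨by linarith, hk2⟩
    refine ⟨k, hk0, ?_⟩
    rw [div_lt_comm₀ hy (ellipticK_pos (Ioo_subset_Ico_self hk0))] at hk
    refine lt_of_le_of_lt ?_ hk
    refine div_le_div_of_nonneg_right ?_ (ellipticK_pos (Ioo_subset_Ico_self hk0)).le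
    exact ellipticK_strictMonoOn.monotoneOn (Ioo_subset_Ico_self (sqrt_one_sub_sq_mem hk0))
      (Ioo_subset_Ico_self (sqrt_one_sub_sq_mem (by norm_num)))
      (sqrt_le_sqrt (by nlinarith))
  have hhigh : ∃ k ∈ Ioo (0 : ℝ) 1, y < quotientG k := by
    have h1 := tendsto_ellipticK.eventually_gt_atTop (y * ellipticK √(1 - (1 / 2) ^ 2))
    obtain ⟨k, hk, hk1, hk2⟩ := (h1.and (Ioo_mem_nhdsLT
      (sqrt_one_sub_sq_mem (x := 1 / 2) (by norm_num)).2)).exists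
    have hk0 : k ∈ Ioo (0 : ℝ) 1 := ⟨lt_of_le_of_lt (sqrt_nonneg _) hk1, hk2⟩
    have hk' := sqrt_one_sub_sq_mem hk0
    refine ⟨√(1 - k ^ 2), hk', ?_⟩
    have hKk := ellipticK_pos (Ioo_subset_Ico_self hk')
    rw [quotientG, sq_sqrt (one_sub_sq_pos hk0.1.le hk0.2).le, sub_sub_cancel, sqrt_sq hk0.1.le,
      lt_div_iff₀ hKk]
    refine lt_of_le_of_lt ?_ hk
    refine mul_le_mul_of_nonneg_left ?_ hy.le
    refine ellipticK_strictMonoOn.monotoneOn (Ioo_subset_Ico_self hk')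
      (Ioo_subset_Ico_self (sqrt_one_sub_sq_mem (by norm_num))) ?_
    have h12 : (0 : ℝ) < 1 - (1 / 2) ^ 2 := by norm_num
    have := (sqrt_lt' hk0.1).1 hk1
    rw [sqrt_le_sqrt_iff h12.le]
    norm_num at this ⊢
    linarith
  obtain ⟨l, hl, hly⟩ := hlow
  obtain ⟨h, hh, hhy⟩ := hhigh
  exact isPreconnected_Ioo.intermediate_value hl hh quotientG_continuousOn ⟨hly.le, hhy.le⟩

lemma two_mul_div_sq_sub_one_pos {a : ℝ} (ha : 1 < a) : 0 < 2 * a / (a ^ 2 - 1) :=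
  div_pos (by linarith) (by nlinarith)

lemma isModulus_unique {a k l : ℝ} (hk : IsModulus a k) (hl : IsModulus a l) : k = l :=
  quotientG_strictAntiOn.injOn hk.1 hl.1 (hk.2.trans hl.2.symm)

lemma isModulus_modulus {a : ℝ} (ha : 1 < a) : IsModulus a (modulus a) := by
  obtain ⟨k, hk, hky⟩ := exists_quotientG_eq (y := 2 / π * arsinh (2 * a / (a ^ 2 - 1)))
    (mul_pos (by positivity) (arsinh_pos_iff.2 (two_mul_div_sq_sub_one_pos ha)))
  exact Classical.epsilon_spec (p := IsModulus a) ⟨k, hk, hky⟩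

lemma modulus_mem {a : ℝ} (ha : 1 < a) : modulus a ∈ Ioo (0 : ℝ) 1 := (isModulus_modulus ha).1

lemma injOn_modulus : InjOn modulus (Ioi 1) := by
  intro a ha b hb hab
  have h1 := (isModulus_modulus ha).2
  rw [hab, (isModulus_modulus hb).2] at h1
  have h2 := arsinh_injective (mul_left_cancel₀ (by positivity) h1)
  have ha' : 0 < a ^ 2 - 1 := by nlinarith [mem_Ioi.1 ha]
  have hb' : 0 < b ^ 2 - 1 := by nlinarith [mem_Ioi.1 hb]
  rw [div_eq_div_iff hb'.ne' ha'.ne'] at h2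
  -- This is the factored form of the cross-multiplied equation a/(a² - 1) = b/(b² - 1).
  have h3 : (a - b) * (a * b + 1) = 0 := by linarith
  rcases mul_eq_zero.1 h3 with h | h
  · linarith
  · nlinarith [mem_Ioi.1 ha, mem_Ioi.1 hb]

lemma exists_modulus_eq {k : ℝ} (hk : k ∈ Ioo (0 : ℝ) 1) : ∃ a : ℝ, 1 < a ∧ modulus a = k := by
  set s := Real.sinh (π / 2 * quotientG k) with hs
  have hs0 : 0 < s := by
    refine Real.sinh_pos_iff.2 (mul_pos (by positivity) (div_pos ?_ ?_))
    · exact ellipticK_pos (Ioo_subset_Ico_self (sqrt_one_sub_sq_mem hk))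
    · exact ellipticK_pos (Ioo_subset_Ico_self hk)
  -- The witness (1 + √(1 + s²))/s used below is the positive root of s a² - 2a - s = 0, that is, of
  -- 2a/(a² - 1) = s.
  have hq : 1 < √(1 + s ^ 2) := by
    rw [lt_sqrt one_pos.le]; nlinarith
  have hq2 : √(1 + s ^ 2) ^ 2 = 1 + s ^ 2 := sq_sqrt (by positivity)
  set r := √(1 + s ^ 2)
  have ha : 1 < (1 + r) / s := by
    rw [lt_div_iff₀ hs0]; nlinarith
  refine ⟨(1 + r) / s, ha, isModulus_unique (isModulus_modulus ha) ⟨hk, ?_⟩⟩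
  have h1 : 2 * ((1 + r) / s) / (((1 + r) / s) ^ 2 - 1) = s := by
    have : 0 < ((1 + r) / s) ^ 2 - 1 := by nlinarith
    rw [div_eq_iff this.ne']
    field_simp
    nlinarith
  rw [h1, hs, arsinh_sinh]
  field_simp

/-! ### The function `g` -/

/-- Half the modulus of `Φ''' / (Φ')³` at the centre of the ellipse with elliptic modulus `k`. -/
def halfRatio (k : ℝ) : ℝ :=
  ((1 + k ^ 2) - (π / (2 * ellipticK k)) ^ 2) / (2 * k)

lemma radicand_eq {k : ℝ} (hk : k ≠ 0) : radicand k = 1 - halfRatio k ^ 2 := by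
  rw [radicand, halfRatio]
  field_simp
  ring

/-- These two bounds are all that is needed of K for 0 < h ≤ k < 1. The lower one also drives the
monotonicity of h. -/
lemma quarter_period_ratio_bounds {k : ℝ} (hk : k ∈ Ico (0 : ℝ) 1) :
    1 - k ^ 2 ≤ (π / (2 * ellipticK k)) ^ 2 ∧ (π / (2 * ellipticK k)) ^ 2 ≤ 1 := by
  have hK := ellipticK_pos hk
  have h0 : 0 ≤ π / (2 * ellipticK k) := by positivity
  have hs := sqrt_pos.2 (one_sub_sq_pos hk.1 hk.2)
  constructor
  · rw [← sq_sqrt (one_sub_sq_pos hk.1 hk.2).le]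
    refine pow_le_pow_left₀ hs.le ?_ 2
    have := ellipticK_le hk
    rw [le_div_iff₀ hs] at this
    rw [le_div_iff₀ (by positivity)]
    linarith
  · refine pow_le_one₀ h0 ?_
    rw [div_le_one (by positivity)]
    linarith [pi_div_two_le_ellipticK hk]

lemma halfRatio_pos {k : ℝ} (hk : k ∈ Ioo (0 : ℝ) 1) : 0 < halfRatio k := by
  have := (quarter_period_ratio_bounds (Ioo_subset_Ico_self hk)).2
  have := hk.1
  refine div_pos ?_ (by linarith)
  nlinarith

lemma halfRatio_le {k : ℝ} (hk : k ∈ Ioo (0 : ℝ) 1) : halfRatio k ≤ k := by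
  have := (quarter_period_ratio_bounds (Ioo_subset_Ico_self hk)).1
  have := hk.1
  rw [halfRatio, div_le_iff₀ (by linarith)]
  nlinarith

/-- No derivative of K is needed. Since m = (π/(2K))² decreases in k, it may be frozen at its value
at the smaller point k. The claim then reduces to (l - k)(kl - 1 + m) > 0, which follows from kl >
k² and m ≥ 1 - k². -/
lemma halfRatio_strictMonoOn : StrictMonoOn halfRatio (Ioo 0 1) := by
  intro k hk l hl hkl
  have hb := quarter_period_ratio_bounds (Ioo_subset_Ico_self hk)
  have hKl := ellipticK_strictMonoOn (Ioo_subset_Ico_self hk) (Ioo_subset_Ico_self hl) hkl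
  have hK := ellipticK_pos (Ioo_subset_Ico_self hk)
  have hm : (π / (2 * ellipticK l)) ^ 2 ≤ (π / (2 * ellipticK k)) ^ 2 := by
    have hK' := hK.trans hKl
    refine pow_le_pow_left₀ (by positivity) ?_ 2
    gcongr
  have hk0 := hk.1
  have hl0 := hl.1
  set m := (π / (2 * ellipticK k)) ^ 2
  set n := (π / (2 * ellipticK l)) ^ 2
  change ((1 + k ^ 2) - m) / (2 * k) < ((1 + l ^ 2) - n) / (2 * l)
  rw [div_lt_div_iff₀ (by linarith) (by linarith)]
  have h1 : k ^ 2 < k * l := by nlinarith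
  have h2 : 0 < (l - k) * (k * l - 1 + m) := mul_pos (by linarith) (by nlinarith [hb.1])
  nlinarith [mul_le_mul_of_nonneg_left hm hk0.le]

lemma halfRatio_continuousOn : ContinuousOn halfRatio (Ioo 0 1) := by
  have hK : ContinuousOn ellipticK (Ioo 0 1) := ellipticK_continuousOn.mono Ioo_subset_Ico_self
  refine ContinuousOn.div ?_ (by fun_prop) fun k hk => by have := hk.1; positivity
  refine ContinuousOn.sub (by fun_prop) (ContinuousOn.pow (ContinuousOn.div (by fun_prop)
    (by fun_prop) fun k hk => ?_) 2)
  have := ellipticK_pos (Ioo_subset_Ico_self hk)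
  positivity

lemma tendsto_halfRatio_one : Tendsto halfRatio (𝓝[<] 1) (𝓝 1) := by
  have h1 : Tendsto (fun k => (π / (2 * ellipticK k)) ^ 2) (𝓝[<] 1) (𝓝 (0 ^ 2)) :=
    (tendsto_const_nhds.div_atTop (tendsto_ellipticK.const_mul_atTop two_pos)).pow 2
  have hid : Tendsto (fun k : ℝ => k) (𝓝[<] 1) (𝓝 1) := nhdsWithin_le_nhds
  have h2 := ((((hid.pow 2).const_add 1).sub h1).div (hid.const_mul 2) (by norm_num))
  norm_num at h2
  exact h2.congr fun k => by simp [halfRatio]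

lemma radicand_pos {k : ℝ} (hk : k ∈ Ioo (0 : ℝ) 1) : 0 < radicand k := by
  rw [radicand_eq hk.1.ne']
  have h1 := halfRatio_pos hk
  have h2 := (halfRatio_le hk).trans_lt hk.2
  nlinarith

lemma g_of_pos {k : ℝ} (hk : 0 < k) : g k = radicand k ^ (-(1 / 2) : ℝ) := if_neg hk.ne'

lemma g_zero : g 0 = 1 := if_pos rfl

lemma g_sq_inv {k : ℝ} (hk : k ∈ Ioo (0 : ℝ) 1) : 0 < g k ∧ 1 / g k ^ 2 = radicand k := by
  have h := radicand_pos hk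
  rw [g_of_pos hk.1]
  refine ⟨rpow_pos_of_pos h _, ?_⟩
  rw [← rpow_natCast, ← rpow_mul h.le, one_div, ← rpow_neg h.le]
  norm_num

lemma g_lt_g {k l : ℝ} (hk : k ∈ Ioo (0 : ℝ) 1) (hl : l ∈ Ioo (0 : ℝ) 1) (hkl : k < l) :
    g k < g l := by
  rw [g_of_pos hk.1, g_of_pos hl.1]
  refine rpow_lt_rpow_of_neg (radicand_pos hl) ?_ (by norm_num)
  rw [radicand_eq hk.1.ne', radicand_eq hl.1.ne']
  have := halfRatio_strictMonoOn hk hl hkl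
  have := halfRatio_pos hk
  nlinarith

lemma one_lt_g {k : ℝ} (hk : k ∈ Ioo (0 : ℝ) 1) : 1 < g k := by
  rw [g_of_pos hk.1]
  refine one_lt_rpow_of_pos_of_lt_one_of_neg (radicand_pos hk) ?_ (by norm_num)
  rw [radicand_eq hk.1.ne']
  have := halfRatio_pos hk
  nlinarith

lemma g_strictMonoOn : StrictMonoOn g (Ico 0 1) := by
  intro k hk l hl hkl
  have hl' : l ∈ Ioo (0 : ℝ) 1 := ⟨hk.1.trans_lt hkl, hl.2⟩
  rcases hk.1.eq_or_lt with rfl | hk0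
  · rw [g_zero]; exact one_lt_g hl'
  · exact g_lt_g ⟨hk0, hk.2⟩ hl' hkl

lemma g_continuousOn : ContinuousOn g (Ico 0 1) := by
  intro x hx
  rcases hx.1.eq_or_lt with rfl | hx0
  · have hlim : Tendsto halfRatio (𝓝[>] 0) (𝓝 0) := by
      refine tendsto_of_tendsto_of_tendsto_of_le_of_le' tendsto_const_nhds
        (nhdsWithin_le_nhds : 𝓝[>] (0 : ℝ) ≤ 𝓝 0) ?_ ?_
      · filter_upwards [Ioo_mem_nhdsGT (zero_lt_one' ℝ)] with k hk using (halfRatio_pos hk).le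
      · filter_upwards [Ioo_mem_nhdsGT (zero_lt_one' ℝ)] with k hk using halfRatio_le hk
    have h2 : Tendsto (fun k => (1 - halfRatio k ^ 2) ^ (-(1 / 2) : ℝ)) (𝓝[>] 0)
        (𝓝 ((1 - 0 ^ 2) ^ (-(1 / 2) : ℝ))) :=
      ((hlim.pow 2).const_sub 1).rpow_const (Or.inl (by norm_num))
    have h3 : ContinuousWithinAt g (Ioi 0) 0 := by
      rw [ContinuousWithinAt, g_zero]
      norm_num at h2
      refine h2.congr' ?_
      filter_upwards [self_mem_nhdsWithin] with k hk
      rw [g_of_pos hk, radicand_eq (ne_of_gt hk)]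
    have h4 : ContinuousWithinAt g (Ici 0) 0 := by
      rw [← Ioi_insert]
      exact continuousWithinAt_insert_self.2 h3
    exact h4.mono Ico_subset_Ici_self
  · have hx' : x ∈ Ioo (0 : ℝ) 1 := ⟨hx0, hx.2⟩
    have hnhds : Ioo (0 : ℝ) 1 ∈ 𝓝 x := isOpen_Ioo.mem_nhds hx'
    refine ContinuousAt.continuousWithinAt ?_
    have hc : ContinuousAt (fun k => (1 - halfRatio k ^ 2) ^ (-(1 / 2) : ℝ)) x := by
      refine ContinuousAt.rpow_const ?_ (Or.inl ?_)
      · exact continuousAt_const.sub ((halfRatio_continuousOn.continuousAt hnhds).pow 2)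
      · rw [← radicand_eq hx0.ne']; exact (radicand_pos hx').ne'
    refine hc.congr ?_
    filter_upwards [hnhds] with k hk
    rw [g_of_pos hk.1, radicand_eq hk.1.ne']

lemma tendsto_g_one : Tendsto g (𝓝[<] 1) atTop := by
  have h1 : Tendsto (fun k => 1 - halfRatio k ^ 2) (𝓝[<] 1) (𝓝[>] 0) := by
    refine tendsto_nhdsWithin_iff.2 ⟨?_, ?_⟩
    · have := (tendsto_halfRatio_one.pow 2).const_sub 1
      norm_num at this
      exact this
    · filter_upwards [Ioo_mem_nhdsLT (zero_lt_one' ℝ)] with k hk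
      rw [← radicand_eq hk.1.ne']; exact radicand_pos hk
  refine ((tendsto_rpow_neg_nhdsGT_zero (y := -(1 / 2)) (by norm_num)).comp h1).congr' ?_
  filter_upwards [Ioo_mem_nhdsLT (zero_lt_one' ℝ)] with k hk
  rw [Function.comp_apply, g_of_pos hk.1, radicand_eq hk.1.ne']

lemma exists_g_eq {y : ℝ} (hy : 1 ≤ y) : ∃ k ∈ Ico (0 : ℝ) 1, g k = y := by
  obtain ⟨l, hl, hl'⟩ := ((tendsto_g_one.eventually_gt_atTop y).and
    (Ioo_mem_nhdsLT (zero_lt_one' ℝ))).exists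
  exact isPreconnected_Ico.intermediate_value (left_mem_Ico.2 one_pos)
    (Ioo_subset_Ico_self hl') g_continuousOn ⟨g_zero ▸ hy, hl.le⟩

lemma existsUnique_g_eq {y : ℝ} (hy : 1 ≤ y) : ∃! k : ℝ, k ∈ Ico (0 : ℝ) 1 ∧ g k = y := by
  obtain ⟨k, hk, hky⟩ := exists_g_eq hy
  exact ⟨k, ⟨hk, hky⟩, fun l hl => g_strictMonoOn.injOn hl.1 hk (hl.2.trans hky.symm)⟩

lemma existsUnique_g_modulus_eq {y : ℝ} (hy : 1 < y) :
    ∃ α : ℝ, 1 < α ∧ g (modulus α) = y ∧ ∀ a : ℝ, 1 < a → g (modulus a) = y → a = α := by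
  obtain ⟨k, hk, hky⟩ := exists_g_eq hy.le
  have hk0 : 0 < k := by
    refine hk.1.lt_of_ne ?_
    rintro rfl
    rw [g_zero] at hky
    exact hy.ne hky
  obtain ⟨α, hα, hαk⟩ := exists_modulus_eq ⟨hk0, hk.2⟩
  refine ⟨α, hα, by rw [hαk, hky], fun a ha hga => injOn_modulus ha hα ?_⟩
  rw [hαk]
  exact g_strictMonoOn.injOn (Ioo_subset_Ico_self (modulus_mem ha)) hk (hga.trans hky.symm)

/-- The exceptional values of the conformal invariant correspond to integral values of `g`. -/
lemma two_mul_halfRatio_notMem {k : ℝ} (hk : k ∈ Ioo (0 : ℝ) 1)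
    (h : ∀ n : ℕ, 2 ≤ n → g k ≠ n) : 2 * halfRatio k ∉ exceptionalValues := by
  have hpos := halfRatio_pos hk
  have hg := g_sq_inv hk
  have hrad := radicand_eq hk.1.ne'
  rintro (⟨n, hn, hx⟩ | hx)
  · have hn' : (1 : ℝ) ≤ n := by exact_mod_cast hn
    have h1 : halfRatio k = √(1 - 1 / (n : ℝ) ^ 2) := by linarith
    have h2 : halfRatio k ^ 2 = 1 - 1 / (n : ℝ) ^ 2 := by
      rw [h1, sq_sqrt]
      rw [sub_nonneg, div_le_one (by positivity)]
      exact one_le_pow₀ hn'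
    have h3 : 1 / g k ^ 2 = 1 / (n : ℝ) ^ 2 := by rw [hg.2, hrad, h2]; ring
    have h4 : g k ^ 2 = (n : ℝ) ^ 2 := by simpa using h3
    have h5 : g k = n := (pow_left_inj₀ hg.1.le (by positivity) two_ne_zero).1 h4
    rcases hn.eq_or_lt with rfl | hn2
    -- The value for n = 1 is 0; it corresponds to g = 1, which is attained only at k = 0.
    · exact (one_lt_g hk).ne' (by simpa using h5)
    · exact h n hn2 h5
  · have := radicand_pos hk
    rw [hrad, show halfRatio k = 1 by linarith] at this
    norm_num at this

/-! ### Injective holomorphic maps -/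

/-- The factor g has an analytic n-th root near z. Dividing by g(z) first moves its value to 1,
where the principal logarithm is analytic. -/
lemma exists_analytic_power_form {F : ℂ → ℂ} {z : ℂ} {n : ℕ} (hn : n ≠ 0) {g : ℂ → ℂ}
    (hg : AnalyticAt ℂ g z) (hgz : g z ≠ 0) (hF : ∀ᶠ x in 𝓝 z, F x = (x - z) ^ n * g x) :
    ∃ ψ : ℂ → ℂ, HasStrictDerivAt ψ 1 z ∧ ψ z = 0 ∧ ∀ᶠ x in 𝓝 z, F x = g z * ψ x ^ n := by
  have hq : AnalyticAt ℂ (fun x => g x / g z) z := hg.div analyticAt_const hgz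
  have hq1 : g z / g z ∈ Complex.slitPlane := by rw [div_self hgz]; exact Complex.one_mem_slitPlane
  have hL : AnalyticAt ℂ (fun x => Complex.exp (Complex.log (g x / g z) / n)) z :=
    ((hq.clog hq1).div analyticAt_const (by exact_mod_cast hn)).cexp
  refine ⟨fun x => (x - z) * Complex.exp (Complex.log (g x / g z) / n), ?_, by simp, ?_⟩
  · have h0 : HasStrictDerivAt (fun x : ℂ => x - z) 1 z := (hasStrictDerivAt_id z).sub_const z
    have h1 := h0.fun_mul hL.hasStrictDerivAt
    simpa [div_self hgz] using h1
  · have hne : ∀ᶠ x in 𝓝 z, g x ≠ 0 := hg.continuousAt.eventually_ne hgz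
    filter_upwards [hF, hne] with x hx hxne
    rw [hx, mul_pow, ← Complex.exp_nat_mul, mul_div_cancel₀ _ (by exact_mod_cast hn),
      Complex.exp_log (div_ne_zero hxne hgz)]
    field_simp

/-- The derivative of an injective holomorphic function does not vanish. -/
lemma deriv_ne_zero_of_injOn {f : ℂ → ℂ} {U : Set ℂ} {z : ℂ} (hU : U ∈ 𝓝 z)
    (hf : AnalyticAt ℂ f z) (hinj : InjOn f U) : deriv f z ≠ 0 := by
  have hF : AnalyticAt ℂ (fun x => f x - f z) z := hf.sub analyticAt_const
  have htop : analyticOrderAt (fun x => f x - f z) z ≠ ⊤ := by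
    intro h
    rw [analyticOrderAt_eq_top] at h
    obtain ⟨x, ⟨hx, hxU⟩, hxz⟩ :=
      ((h.and hU).filter_mono (nhdsWithin_le_nhds (s := {z}ᶜ))).and self_mem_nhdsWithin |>.exists
    exact hxz (hinj hxU (mem_of_mem_nhds hU) (sub_eq_zero.1 hx))
  obtain ⟨g, hg, hgz, hfg⟩ := hF.analyticOrderAt_ne_top.1 htop
  set n := analyticOrderNatAt (fun x => f x - f z) z
  have hn : n ≠ 0 := by
    intro h
    have := hfg.self_of_nhds
    simp [h] at this
    exact hgz this.symm
  obtain ⟨ψ, hψ, hψ0, hfψ⟩ := exists_analytic_power_form hn hg hgz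
    (F := fun x => f x - f z) (hfg.mono fun x hx => hx)
  have hmap := hψ.map_nhds_eq one_ne_zero
  rw [hψ0] at hmap
  by_cases hn1 : n = 1
  · rw [hn1] at hfψ
    have h1 : HasDerivAt (fun x => g z * ψ x ^ 1) (g z) z := by
      simpa using hψ.hasDerivAt.const_mul (g z)
    have h2 : HasDerivAt (fun x => f x - f z) (g z) z := h1.congr_of_eventuallyEq hfψ
    have h3 := h2.add_const (f z)
    simp only [sub_add_cancel] at h3
    rwa [h3.deriv]
  -- For order n ≥ 2, ψ takes both values ε/2 and ζε/2 near z, where ζ is a primitive n-th root of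
  -- unity. These have the same n-th power, which contradicts injectivity.
  · have himg : ψ '' (U ∩ {x | f x - f z = g z * ψ x ^ n}) ∈ 𝓝 (0 : ℂ) :=
      hmap ▸ image_mem_map (inter_mem hU hfψ)
    obtain ⟨ε, hε, hball⟩ := Metric.mem_nhds_iff.1 himg
    set ζ := Complex.exp (2 * π * Complex.I / n)
    have hζ : IsPrimitiveRoot ζ n := Complex.isPrimitiveRoot_exp n hn
    have hw : ((ε / 2 : ℝ) : ℂ) ∈ Metric.ball (0 : ℂ) ε := by
      rw [mem_ball_zero_iff, Complex.norm_real, Real.norm_of_nonneg (by positivity)]; linarith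
    have hw' : ((ε / 2 : ℝ) : ℂ) * ζ ∈ Metric.ball (0 : ℂ) ε := by
      rw [mem_ball_zero_iff, norm_mul, hζ.norm'_eq_one hn, mul_one, ← mem_ball_zero_iff]; exact hw
    obtain ⟨x, ⟨hxU, hx⟩, hxw⟩ := hball hw
    obtain ⟨y, ⟨hyU, hy⟩, hyw⟩ := hball hw'
    simp only [mem_ofPred_eq] at hx hy
    have hxy : f x = f y := by
      rw [hxw] at hx
      rw [hyw, mul_pow, hζ.pow_eq_one, mul_one, ← hx] at hy
      exact (sub_left_inj.1 hy).symm
    have : x = y := hinj hxU hyU hxy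
    subst this
    have h1 : ((ε / 2 : ℝ) : ℂ) * ζ = ((ε / 2 : ℝ) : ℂ) * 1 := by rw [← hyw, hxw, mul_one]
    have hε0 : ((ε / 2 : ℝ) : ℂ) ≠ 0 := by exact_mod_cast (by positivity : (ε / 2 : ℝ) ≠ 0)
    exact absurd (mul_left_cancel₀ hε0 h1) (hζ.ne_one (by omega))

lemma exists_holomorphic_inverse {f : ℂ → ℂ} {U V : Set ℂ} (hU : IsOpen U)
    (hf : DifferentiableOn ℂ f U) (hbij : BijOn f U V) :
    ∃ k : ℂ → ℂ, DifferentiableOn ℂ k V ∧ MapsTo k V U ∧ (∀ w ∈ V, f (k w) = w) ∧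
      ∀ z ∈ U, k (f z) = z := by
  have hinv := hbij.invOn_invFunOn
  have hmaps := hbij.surjOn.mapsTo_invFunOn
  refine ⟨Function.invFunOn f U, fun w hw => ?_, hmaps, hinv.2, hinv.1⟩
  set k := Function.invFunOn f U
  have hkw : k w ∈ U := hmaps hw
  have hUn := hU.mem_nhds hkw
  have han : AnalyticAt ℂ f (k w) := hf.analyticAt hUn
  have hd := deriv_ne_zero_of_injOn hUn han hbij.injOn
  have hmap := han.hasStrictDerivAt.map_nhds_eq hd
  have hfk : f (k w) = w := hinv.2 hw
  rw [hfk] at hmap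
  have hcont : ContinuousAt k w := by
    intro S hS
    have h1 : f '' (S ∩ U) ∈ 𝓝 w := hmap ▸ image_mem_map (inter_mem hS hUn)
    rw [mem_map]
    refine mem_of_superset h1 ?_
    rintro _ ⟨x, ⟨hxS, hxU⟩, rfl⟩
    change k (f x) ∈ S
    rwa [hinv.1 hxU]
  have hev : ∀ᶠ y in 𝓝 w, f (k y) = y := by
    have h1 : f '' U ∈ 𝓝 w := hmap ▸ image_mem_map hUn
    rw [hbij.image_eq] at h1
    filter_upwards [h1] with y hy using hinv.2 hy
  exact (HasDerivAt.of_local_left_inverse hcont han.differentiableAt.hasDerivAt hd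
    hev).differentiableAt.differentiableWithinAt

/-- Conformal maps onto the disc with the same zero agree up to a rotation. -/
lemma conformal_unique {D : Set ℂ} (hD : IsOpen D) {ξ : ℂ} (hξ : ξ ∈ D) {Φ Ψ : ℂ → ℂ}
    (hΦ : IsConformalOntoDisc D Φ) (hΨ : IsConformalOntoDisc D Ψ) (hΦ0 : Φ ξ = 0)
    (hΨ0 : Ψ ξ = 0) : ∃ c : ℂ, ‖c‖ = 1 ∧ ∀ z ∈ D, Ψ z = c * Φ z := by
  obtain ⟨k, hkd, hkm, hfk, hkf⟩ := exists_holomorphic_inverse hD hΦ.1 hΦ.2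
  obtain ⟨l, hld, hlm, hfl, hlf⟩ := exists_holomorphic_inverse hD hΨ.1 hΨ.2
  have hk0 : k 0 = ξ := by rw [← hΦ0, hkf ξ hξ]
  have hl0 : l 0 = ξ := by rw [← hΨ0, hlf ξ hξ]
  have hh : DifferentiableOn ℂ (Ψ ∘ k) (Metric.ball 0 1) := hΨ.1.comp hkd hkm
  have hh' : DifferentiableOn ℂ (Φ ∘ l) (Metric.ball 0 1) := hΦ.1.comp hld hlm
  have hhm : MapsTo (Ψ ∘ k) (Metric.ball 0 1) (Metric.ball 0 1) := hΨ.2.mapsTo.comp hkm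
  have hhm' : MapsTo (Φ ∘ l) (Metric.ball 0 1) (Metric.ball 0 1) := hΦ.2.mapsTo.comp hlm
  have hh0 : (Ψ ∘ k) 0 = 0 := by simp [hk0, hΨ0]
  have hh0' : (Φ ∘ l) 0 = 0 := by simp [hl0, hΦ0]
  -- Any nonzero point of the disc would serve. The Schwarz lemma for Ψ ∘ Φ⁻¹ and for its inverse
  -- forces equality there, and the equality case makes the composition linear.
  have hhalf : ((1 / 2 : ℝ) : ℂ) ∈ Metric.ball (0 : ℂ) 1 := by
    rw [mem_ball_zero_iff, Complex.norm_real]; norm_num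
  set w := ((1 / 2 : ℝ) : ℂ)
  have hw0 : w ≠ 0 := by simp [w]
  have h1 : ‖(Ψ ∘ k) w‖ ≤ ‖w‖ := Complex.norm_le_norm_of_mapsTo_ball hh
    (fun x hx => Metric.ball_subset_closedBall (hhm hx)) hh0 (mem_ball_zero_iff.1 hhalf)
  have h2 : ‖(Φ ∘ l) ((Ψ ∘ k) w)‖ ≤ ‖(Ψ ∘ k) w‖ := Complex.norm_le_norm_of_mapsTo_ball hh'
    (fun x hx => Metric.ball_subset_closedBall (hhm' hx)) hh0' (mem_ball_zero_iff.1 (hhm hhalf))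
  have h3 : (Φ ∘ l) ((Ψ ∘ k) w) = w := by
    simp only [Function.comp_apply]
    rw [hlf _ (hkm hhalf), hfk _ hhalf]
  have h4 : ‖(Ψ ∘ k) w‖ = ‖w‖ := le_antisymm h1 (by rwa [h3] at h2)
  have h5 : ‖dslope (Ψ ∘ k) 0 w‖ = 1 / 1 := by
    rw [dslope_of_ne _ hw0, slope_def_field, hh0, sub_zero, sub_zero, norm_div, h4,
      div_self (norm_ne_zero_iff.2 hw0), div_one]
  obtain ⟨c, hc, hceq⟩ := Complex.affine_of_mapsTo_ball_of_exists_norm_dslope_eq_div' hh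
    (R₂ := 1) (fun x hx => by rw [hh0]; exact Metric.ball_subset_closedBall (hhm hx)) ⟨w, hhalf, h5⟩
  refine ⟨c, by simpa using hc, fun z hz => ?_⟩
  have h6 := hceq (hΦ.2.mapsTo hz)
  simp only [hh0, sub_zero, zero_add, smul_eq_mul] at h6
  rw [Function.comp_apply, hkf z hz] at h6
  rw [h6, mul_comm]

/-! ### A criterion for bijectivity onto the disc -/

lemma norm_dslope_lower {f : ℂ → ℂ} {S : Set ℂ} {z : ℂ} {c : ℝ} (hS : S ∈ 𝓝 z)
    (hf : DifferentiableAt ℂ f z) (h : ∀ x ∈ S, c * ‖x - z‖ ≤ ‖f x - f z‖) :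
    ∀ x ∈ S, c ≤ ‖dslope f z x‖ := by
  have hne : ∀ x ∈ S, x ≠ z → c ≤ ‖dslope f z x‖ := by
    intro x hx hxz
    rw [dslope_of_ne _ hxz, slope_def_field, norm_div, le_div_iff₀ (norm_pos_iff.2 (sub_ne_zero.2 hxz))]
    exact h x hx
  intro x hx
  by_cases hxz : x = z
  · subst hxz
    have hc : Tendsto (fun y => ‖dslope f x y‖) (𝓝[≠] x) (𝓝 ‖dslope f x x‖) :=
      ((continuousAt_dslope_same.2 hf).norm.tendsto).mono_left nhdsWithin_le_nhds
    refine ge_of_tendsto hc ?_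
    filter_upwards [mem_nhdsWithin_of_mem_nhds hS, self_mem_nhdsWithin] with y hy hyx
    exact hne y hy hyx
  · exact hne x hx hxz

lemma norm_sub_eq_dslope (f : ℂ → ℂ) (z x : ℂ) : ‖f x - f z‖ = ‖dslope f z x‖ * ‖x - z‖ := by
  rw [← sub_smul_dslope, norm_smul, mul_comm]

section Criterion

variable {f : ℂ → ℂ} {U : Set ℂ} {d : ℝ}

/-- This is the maximum principle for 1/`dslope f z`. On the frontier |f(y) - f(z)| ≥ 1 - |f(z)|,
while |y - z| ≤ d. The bound depends on z only through |f(z)|, which is what allows a passage to the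
limit later. -/
lemma dslope_lower_of_ne_zero (hUo : IsOpen U) (hUb : Bornology.IsBounded U)
    (hf : DifferentiableOn ℂ f U) (hfc : ContinuousOn f (closure U)) (hd : 0 < d)
    (hdiam : ∀ x ∈ closure U, ∀ y ∈ closure U, ‖x - y‖ ≤ d) (hfr : ∀ z ∈ frontier U, ‖f z‖ = 1)
    {z : ℂ} (hz : z ∈ U) (hfz : ‖f z‖ < 1) (hne : ∀ x ∈ closure U, dslope f z x ≠ 0) :
    ∀ x ∈ closure U, (1 - ‖f z‖) / d ≤ ‖dslope f z x‖ := by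
  have hpos : 0 < (1 - ‖f z‖) / d := div_pos (by linarith) hd
  have hUz := hUo.mem_nhds hz
  have hcl : closure U ∈ 𝓝 z := mem_of_superset hUz subset_closure
  have hinv : DiffContOnCl ℂ (fun x => (dslope f z x)⁻¹) U := by
    refine ⟨((Complex.differentiableOn_dslope hUz).2 hf).inv fun x hx => hne x (subset_closure hx), ?_⟩
    exact ((continuousOn_dslope hcl).2 ⟨hfc, hf.differentiableAt hUz⟩).inv₀ hne
  intro x hx
  have h := Complex.norm_le_of_forall_mem_frontier_norm_le hUb hinv
    (C := ((1 - ‖f z‖) / d)⁻¹) (fun y hy => ?_) hx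
  · rw [norm_inv] at h
    exact (inv_le_inv₀ (norm_pos_iff.2 (hne x hx)) hpos).1 h
  · have hyc := frontier_subset_closure hy
    rw [norm_inv]
    refine inv_anti₀ hpos ?_
    rw [div_le_iff₀ hd]
    have h1 : 1 - ‖f z‖ ≤ ‖f y - f z‖ := hfr y hy ▸ norm_sub_norm_le _ _
    rw [norm_sub_eq_dslope] at h1
    exact h1.trans (mul_le_mul_of_nonneg_left (hdiam y hyc z (subset_closure hz)) (norm_nonneg _))

/-- Having a single simple preimage is an open condition on the value. By the lower bound, any point
with value close to f(z) lies near z, where f has a local inverse. -/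
lemma eventually_dslope_ne_zero (hUo : IsOpen U) (hf : DifferentiableOn ℂ f U) {z : ℂ}
    (hz : z ∈ U) {c : ℝ} (hc : 0 < c) (hlow : ∀ x ∈ closure U, c ≤ ‖dslope f z x‖) :
    ∀ᶠ w in 𝓝 (f z), ∃ z₁ ∈ U, f z₁ = w ∧ ∀ x ∈ closure U, dslope f z₁ x ≠ 0 := by
  have hUz := hUo.mem_nhds hz
  have han : AnalyticAt ℂ f z := hf.analyticAt hUz
  have hd : deriv f z ≠ 0 := by
    have := hlow z (subset_closure hz)
    rw [dslope_same] at this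
    exact norm_pos_iff.1 (hc.trans_le this)
  have hstrict := han.hasStrictDerivAt
  have hdn : ∀ᶠ x in 𝓝 z, deriv f x ≠ 0 := han.deriv.continuousAt.eventually_ne hd
  have hleft := hstrict.eventually_left_inverse hd
  obtain ⟨ε, hε, hball⟩ := Metric.eventually_nhds_iff_ball.1 ((hdn.and hleft).and hUz)
  have himg : f '' Metric.ball z ε ∈ 𝓝 (f z) :=
    hstrict.map_nhds_eq hd ▸ image_mem_map (Metric.ball_mem_nhds z hε)
  filter_upwards [himg, Metric.ball_mem_nhds (f z) (mul_pos hc hε)] with w hw hwε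
  obtain ⟨z₁, hz₁, rfl⟩ := hw
  refine ⟨z₁, (hball z₁ hz₁).2, rfl, fun x hx => ?_⟩
  by_cases hxz : x = z₁
  · rw [hxz, dslope_same]; exact (hball z₁ hz₁).1.1
  · rw [dslope_of_ne _ hxz, slope_def_field]
    refine div_ne_zero (fun h => hxz ?_) (sub_ne_zero.2 hxz)
    have hfx : f x = f z₁ := sub_eq_zero.1 h
    have hxb : x ∈ Metric.ball z ε := by
      rw [Metric.mem_ball, dist_eq_norm] at hwε ⊢
      rw [← hfx, norm_sub_eq_dslope] at hwε
      have := mul_le_mul_of_nonneg_right (hlow x hx) (norm_nonneg (x - z))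
      exact lt_of_mul_lt_mul_left (this.trans_lt hwε) hc.le
    rw [← (hball x hxb).1.2, ← (hball z₁ hz₁).1.2, hfx]

/-- A holomorphic function on a bounded connected open set whose modulus is `1` on the frontier
and which has exactly one zero, a simple one, maps the set bijectively onto the unit disc. -/
lemma bijOn_ball_of_unimodular_frontier (hUo : IsOpen U) (hUb : Bornology.IsBounded U)
    (hUc : IsPreconnected U) (hf : DifferentiableOn ℂ f U) (hfc : ContinuousOn f (closure U))
    (hfr : ∀ z ∈ frontier U, ‖f z‖ = 1) {z₀ : ℂ} (hz₀ : z₀ ∈ U) (hf0 : f z₀ = 0)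
    (hd0 : deriv f z₀ ≠ 0) (hzero : ∀ z ∈ U, f z = 0 → z = z₀) :
    BijOn f U (Metric.ball 0 1) := by
  have hle : ∀ z ∈ closure U, ‖f z‖ ≤ 1 := fun z hz =>
    Complex.norm_le_of_forall_mem_frontier_norm_le hUb ⟨hf, hfc⟩ (fun w hw => (hfr w hw).le) hz
  have hmaps : MapsTo f U (Metric.ball 0 1) := by
    intro z hz
    rw [mem_ball_zero_iff]
    refine (hle z (subset_closure hz)).lt_of_ne fun h => ?_
    have hmax : IsMaxOn (norm ∘ f) U z := isMaxOn_iff.2 fun x hx => by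
      simpa [h] using hle x (subset_closure hx)
    have := Complex.norm_eqOn_of_isPreconnected_of_isMaxOn hUc hUo hf hz hmax hz₀
    simp [hf0, h] at this
  obtain ⟨M, hM⟩ := hUb.closure.exists_norm_le
  set d := 2 * |M| + 1
  have hd : 0 < d := by positivity
  have hdiam : ∀ x ∈ closure U, ∀ y ∈ closure U, ‖x - y‖ ≤ d := fun x hx y hy => by
    have := norm_sub_le x y
    have := hM x hx
    have := hM y hy
    have := le_abs_self M
    simp only [d]
    linarith
  -- Nonvanishing of `dslope f z` on the closure says that z is the only point there with its value
  -- and that f'(z) ≠ 0. So W consists of the values taken exactly once and simply. It contains 0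
  -- and is open and relatively closed in the disc; this takes the place of the argument principle.
  set W : Set ℂ := {w | ‖w‖ < 1 ∧ ∃ z ∈ U, f z = w ∧ ∀ x ∈ closure U, dslope f z x ≠ 0} with hW
  have hlow : ∀ w, ‖w‖ < 1 → ∀ z ∈ U, f z = w → (∀ x ∈ closure U, dslope f z x ≠ 0) →
      ∀ x ∈ closure U, (1 - ‖w‖) / d ≤ ‖dslope f z x‖ := by
    rintro w hw z hz rfl hne
    exact dslope_lower_of_ne_zero hUo hUb hf hfc hd hdiam hfr hz hw hne
  have hWopen : IsOpen W := by
    rw [isOpen_iff_mem_nhds]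
    rintro w ⟨hw, z, hz, rfl, hne⟩
    have hev := eventually_dslope_ne_zero hUo hf hz (div_pos (sub_pos.2 hw) hd)
      (hlow _ hw z hz rfl hne)
    filter_upwards [hev, (isOpen_lt continuous_norm continuous_const).mem_nhds hw] with v hv hv1
    exact ⟨hv1, hv⟩
  have hWne : (Metric.ball (0 : ℂ) 1 ∩ W).Nonempty := by
    refine ⟨0, by simp, by simp, z₀, hz₀, hf0, fun x hx => ?_⟩
    by_cases hxz : x = z₀
    · rw [hxz, dslope_same]; exact hd0
    · rw [dslope_of_ne _ hxz, slope_def_field, hf0, sub_zero]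
      refine div_ne_zero (fun h => hxz ?_) (sub_ne_zero.2 hxz)
      by_cases hxU : x ∈ U
      · exact hzero x hxU h
      · have := hfr x (by rw [hUo.frontier_eq]; exact ⟨hx, hxU⟩)
        simp [h] at this
  have hWcl : closure W ∩ Metric.ball 0 1 ⊆ W := by
    rintro w ⟨hwW, hw1⟩
    rw [mem_ball_zero_iff] at hw1
    obtain ⟨u, huW, hu⟩ := mem_closure_iff_seq_limit.1 hwW
    choose hu1 z hzU hfz hne using huW
    obtain ⟨z', hz', φ, hφ, hlim⟩ := hUb.isCompact_closure.tendsto_subseq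
      fun n => subset_closure (hzU n)
    have huφ : Tendsto (fun n => u (φ n)) atTop (𝓝 w) := hu.comp hφ.tendsto_atTop
    have hfz' : f z' = w := by
      have h1 : Tendsto (fun n => f (z (φ n))) atTop (𝓝 (f z')) :=
        (hfc z' hz').tendsto.comp (tendsto_nhdsWithin_iff.2
          ⟨hlim, Eventually.of_forall fun n => subset_closure (hzU _)⟩)
      simp only [hfz] at h1
      exact tendsto_nhds_unique h1 huφ
    have hz'U : z' ∈ U := by
      by_contra hnot
      have := hfr z' (by rw [hUo.frontier_eq]; exact ⟨hz', hnot⟩)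
      rw [hfz'] at this
      exact hw1.ne this
    refine ⟨hw1, z', hz'U, hfz', fun x hx => ?_⟩
    -- The limit is taken in the form without a quotient, which is continuous in the base point z.
    -- `norm_dslope_lower` then restores the bound on the difference quotient.
    have hbound : ∀ y ∈ closure U, (1 - ‖w‖) / d * ‖y - z'‖ ≤ ‖f y - f z'‖ := by
      intro y hy
      have h1 : Tendsto (fun n => (1 - ‖u (φ n)‖) / d * ‖y - z (φ n)‖) atTop
          (𝓝 ((1 - ‖w‖) / d * ‖y - z'‖)) :=
        ((huφ.norm.const_sub 1).div_const d).mul (hlim.const_sub y).norm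
      have h2 : Tendsto (fun n => ‖f y - u (φ n)‖) atTop (𝓝 ‖f y - w‖) := (huφ.const_sub _).norm
      rw [hfz']
      refine le_of_tendsto_of_tendsto' h1 h2 fun n => ?_
      rw [← hfz (φ n), norm_sub_eq_dslope, hfz (φ n)]
      exact mul_le_mul_of_nonneg_right
        (hlow _ (hu1 _) _ (hzU _) (hfz _) (hne _) y hy) (norm_nonneg _)
    have h3 := norm_dslope_lower (mem_of_superset (hUo.mem_nhds hz'U) subset_closure)
      (hf.differentiableAt (hUo.mem_nhds hz'U)) hbound x hx
    exact norm_pos_iff.1 ((div_pos (sub_pos.2 hw1) hd).trans_le h3)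
  have hsub := (convex_ball (0 : ℂ) 1).isPreconnected.subset_of_closure_inter_subset hWopen hWne hWcl
  refine ⟨hmaps, fun x hx y hy hxy => ?_, fun w hw => ?_⟩
  · obtain ⟨-, z, -, hfz, hne⟩ := hsub (hmaps hx)
    have key : ∀ t ∈ U, f t = f x → t = z := fun t ht htx => by
      by_contra htz
      have h := hne t (subset_closure ht)
      rw [dslope_of_ne _ htz, slope_def_field, htx, hfz, sub_self, zero_div] at h
      exact h rfl
    rw [key x hx rfl, key y hy hxy.symm]
  · obtain ⟨-, z, hz, hfz, -⟩ := hsub hw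
    exact ⟨z, hz, hfz⟩

end Criterion

/-! ### The ellipse -/

lemma ellipse_eq_image {a : ℝ} (ha : 1 < a) :
    ellipse a = (fun w : ℂ => (⟨a * w.re, w.im⟩ : ℂ)) '' Metric.ball 0 1 := by
  have ha0 : a ≠ 0 := by positivity
  ext z
  rw [mem_image]
  constructor
  · intro hz
    refine ⟨⟨z.re / a, z.im⟩, ?_, by apply Complex.ext <;> simp; field_simp⟩
    rw [mem_ball_zero_iff, ← sq_lt_one_iff₀ (norm_nonneg _), Complex.sq_norm, Complex.normSq_mk]
    have : z.re ^ 2 / a ^ 2 + z.im ^ 2 < 1 := hz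
    have h : z.re / a * (z.re / a) + z.im * z.im = z.re ^ 2 / a ^ 2 + z.im ^ 2 := by field_simp
    rwa [h]
  · rintro ⟨w, hw, rfl⟩
    rw [mem_ball_zero_iff, ← sq_lt_one_iff₀ (norm_nonneg _), Complex.sq_norm, Complex.normSq_apply] at hw
    change (a * w.re) ^ 2 / a ^ 2 + w.im ^ 2 < 1
    have h : (a * w.re) ^ 2 / a ^ 2 + w.im ^ 2 = w.re * w.re + w.im * w.im := by field_simp
    rwa [h]

lemma isOpen_ellipse (a : ℝ) : IsOpen (ellipse a) :=
  isOpen_lt (by fun_prop) continuous_const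

lemma continuous_stretch (a : ℝ) : Continuous fun w : ℂ => (⟨a * w.re, w.im⟩ : ℂ) := by
  have : (fun w : ℂ => (⟨a * w.re, w.im⟩ : ℂ)) =
      fun w : ℂ => ((a * w.re : ℝ) : ℂ) + (w.im : ℂ) * Complex.I := by
    funext w; rw [Complex.mk_eq_add_mul_I]
  rw [this]
  fun_prop

lemma isPreconnected_ellipse {a : ℝ} (ha : 1 < a) : IsPreconnected (ellipse a) := by
  rw [ellipse_eq_image ha]
  exact (convex_ball (0 : ℂ) 1).isPreconnected.image _ (continuous_stretch a).continuousOn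

lemma closure_ellipse_subset (a : ℝ) :
    closure (ellipse a) ⊆ {z | z.re ^ 2 / a ^ 2 + z.im ^ 2 ≤ 1} :=
  closure_lt_subset_le (by fun_prop) continuous_const

lemma frontier_ellipse_subset (a : ℝ) :
    frontier (ellipse a) ⊆ {z | z.re ^ 2 / a ^ 2 + z.im ^ 2 = 1} :=
  frontier_lt_subset_eq (by fun_prop) continuous_const

lemma isBounded_ellipse {a : ℝ} (ha : 1 < a) : Bornology.IsBounded (ellipse a) := by
  refine (Metric.isBounded_closedBall (x := (0 : ℂ)) (r := a)).subset fun z hz => ?_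
  have hz' : z.re ^ 2 / a ^ 2 + z.im ^ 2 < 1 := hz
  rw [mem_closedBall_zero_iff, ← sq_le_sq₀ (norm_nonneg _) (by linarith), Complex.sq_norm,
    Complex.normSq_apply]
  have h1 : z.re ^ 2 / a ^ 2 * a ^ 2 = z.re ^ 2 := div_mul_cancel₀ _ (by positivity)
  have h2 : 1 ≤ a ^ 2 := by nlinarith
  nlinarith [sq_nonneg z.im]

lemma zero_mem_ellipse (a : ℝ) : (0 : ℂ) ∈ ellipse a := by simp [ellipse]

/-- A strip to which the conformal map of the ellipse extends holomorphically. -/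
def strip : Set ℂ := {z | |z.im| < 2}

lemma isOpen_strip : IsOpen strip := isOpen_lt (by fun_prop) continuous_const

lemma closure_ellipse_subset_strip (a : ℝ) : closure (ellipse a) ⊆ strip := by
  intro z hz
  have h : z.re ^ 2 / a ^ 2 + z.im ^ 2 ≤ 1 := closure_ellipse_subset a hz
  have h0 : 0 ≤ z.re ^ 2 / a ^ 2 := by positivity
  change |z.im| < 2
  rw [abs_lt]
  constructor <;> nlinarith

/-- The point of the boundary ellipse with eccentric anomaly `θ`. -/
def boundaryPoint (a θ : ℝ) : ℂ := ⟨a * Real.cos θ, Real.sin θ⟩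

lemma exists_boundaryPoint {a : ℝ} (ha : 1 < a) {z : ℂ} (hz : z ∈ frontier (ellipse a)) :
    ∃ θ, z = boundaryPoint a θ := by
  have ha0 : a ≠ 0 := by positivity
  have h : z.re ^ 2 / a ^ 2 + z.im ^ 2 = 1 := frontier_ellipse_subset a hz
  have hn : ‖(⟨z.re / a, z.im⟩ : ℂ)‖ = 1 := by
    rw [← pow_eq_one_iff_of_nonneg (norm_nonneg _) two_ne_zero, Complex.sq_norm, Complex.normSq_mk, ← h]
    field_simp
  obtain ⟨θ, hθ⟩ := Complex.norm_eq_one_iff _ |>.1 hn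
  refine ⟨θ, ?_⟩
  have h1 := congrArg Complex.re hθ
  have h2 := congrArg Complex.im hθ
  rw [Complex.exp_ofReal_mul_I_re] at h1
  rw [Complex.exp_ofReal_mul_I_im] at h2
  apply Complex.ext
  · simp only [boundaryPoint, h1]; field_simp
  · simp only [boundaryPoint, h2]

/-! ### Infinite products -/

/-- The canonical product `∏ (1 + βₙ s)`. -/
def canonicalProd (β : ℕ → ℝ) (s : ℂ) : ℂ := ∏' n, (1 + (β n : ℂ) * s)

section CanonicalProd

variable {β : ℕ → ℝ}

lemma canonicalProd_multipliable (hβ : Summable fun n => |β n|) (s : ℂ) :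
    Multipliable fun n => 1 + (β n : ℂ) * s := by
  refine multipliable_one_add_of_summable ?_
  simpa [norm_mul] using hβ.mul_right ‖s‖

lemma canonicalProd_tendsto (hβ : Summable fun n => |β n|) (s : ℂ) :
    Tendsto (fun N => ∏ n ∈ Finset.range N, (1 + (β n : ℂ) * s)) atTop (𝓝 (canonicalProd β s)) :=
  (canonicalProd_multipliable hβ s).hasProd.tendsto_prod_nat

lemma canonicalProd_differentiable (hβ : Summable fun n => |β n|) :
    Differentiable ℂ (canonicalProd β) := by
  intro s
  have h : HasProdLocallyUniformlyOn (fun n (x : ℂ) => 1 + (β n : ℂ) * x)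
      (fun x => ∏' n, (1 + (β n : ℂ) * x)) (Metric.ball 0 (‖s‖ + 1)) := by
    refine Summable.hasProdLocallyUniformlyOn_nat_one_add Metric.isOpen_ball
      (hβ.mul_right (‖s‖ + 1)) (Eventually.of_forall fun n x hx => ?_) fun n => by fun_prop
    rw [norm_mul, Complex.norm_real, Real.norm_eq_abs]
    exact mul_le_mul_of_nonneg_left (mem_ball_zero_iff.1 hx).le (abs_nonneg _)
  have hd := h.differentiableOn (Eventually.of_forall fun t => by
    simpa [Finset.prod_fn] using
      DifferentiableOn.finsetProd (fun _ _ => by fun_prop)) Metric.isOpen_ball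
  exact hd.differentiableAt (Metric.isOpen_ball.mem_nhds (by simp))

lemma canonicalProd_ne_zero (hβ : Summable fun n => |β n|) {s : ℂ}
    (h : ∀ n, 1 + (β n : ℂ) * s ≠ 0) : canonicalProd β s ≠ 0 := by
  refine tprod_one_add_ne_zero_of_summable h ?_
  simpa [norm_mul] using hβ.mul_right ‖s‖

lemma canonicalProd_conj (hβ : Summable fun n => |β n|) (s : ℂ) :
    canonicalProd β (starRingEnd ℂ s) = starRingEnd ℂ (canonicalProd β s) := by
  have h1 := canonicalProd_tendsto hβ (starRingEnd ℂ s)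
  have h2 := (Complex.continuous_conj.tendsto _).comp (canonicalProd_tendsto hβ s)
  refine tendsto_nhds_unique h1 (h2.congr fun N => ?_)
  simp [map_prod]

lemma canonicalProd_zero : canonicalProd β 0 = 1 := by simp [canonicalProd]

end CanonicalProd

/-! ### The coefficients of the product for the ellipse -/

/-- The square root of the nome of the ellipse. -/
def nomeRoot (a : ℝ) : ℝ := (a - 1) / (a + 1)

/-- The coefficients of the theta products in the variable `z²`. -/
def coeff (a : ℝ) (m : ℕ) : ℝ :=
  4 * (nomeRoot a ^ 2) ^ m / ((1 - (nomeRoot a ^ 2) ^ m) ^ 2 * (a ^ 2 - 1))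

section Coeff

variable {a : ℝ}

lemma nomeRoot_mem (ha : 1 < a) : nomeRoot a ∈ Ioo (0 : ℝ) 1 :=
  ⟨div_pos (by linarith) (by linarith), by rw [nomeRoot, div_lt_one (by linarith)]; linarith⟩

lemma nomeRoot_sq_mem (ha : 1 < a) : nomeRoot a ^ 2 ∈ Ioo (0 : ℝ) 1 := by
  have := nomeRoot_mem ha
  exact ⟨pow_pos this.1 2, by nlinarith [this.1, this.2]⟩

lemma one_sub_nome_pow_pos (ha : 1 < a) {m : ℕ} (hm : m ≠ 0) : 0 < 1 - (nomeRoot a ^ 2) ^ m :=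
  sub_pos.2 (pow_lt_one₀ (nomeRoot_sq_mem ha).1.le (nomeRoot_sq_mem ha).2 hm)

lemma coeff_pos (ha : 1 < a) {m : ℕ} (hm : m ≠ 0) : 0 < coeff a m := by
  have h1 := one_sub_nome_pow_pos ha hm
  have h2 := (nomeRoot_sq_mem ha).1
  have h3 : 0 < a ^ 2 - 1 := by nlinarith
  rw [coeff]
  positivity

lemma coeff_le (ha : 1 < a) {m : ℕ} (hm : m ≠ 0) :
    coeff a m ≤ 4 / ((1 - nomeRoot a ^ 2) ^ 2 * (a ^ 2 - 1)) * (nomeRoot a ^ 2) ^ m := by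
  have hq := nomeRoot_sq_mem ha
  have h0 : 0 < 1 - nomeRoot a ^ 2 := sub_pos.2 hq.2
  have h1 : 1 - nomeRoot a ^ 2 ≤ 1 - (nomeRoot a ^ 2) ^ m :=
    sub_le_sub_left (pow_le_of_le_one hq.1.le hq.2.le hm) 1
  have h3 : 0 < a ^ 2 - 1 := by nlinarith
  have h4 := hq.1
  rw [coeff, div_mul_eq_mul_div]
  gcongr

/-- The bound comes from m = 1, where the coefficient is (a² - 1)/(4a²). Being below 1/4, it keeps
all zeros of the factors 1 + `coeff a m` z² off |Im z| < 2, so the quotient is holomorphic across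
the boundary ellipse. -/
lemma coeff_lt (ha : 1 < a) {m : ℕ} (hm : m ≠ 0) : coeff a m < 1 / 4 := by
  have hq := nomeRoot_sq_mem ha
  have h3 : 0 < a ^ 2 - 1 := by nlinarith
  have h0 : 0 < 1 - nomeRoot a ^ 2 := sub_pos.2 hq.2
  refine (coeff_le ha hm).trans_lt ?_
  have h1 : (nomeRoot a ^ 2) ^ m ≤ nomeRoot a ^ 2 := pow_le_of_le_one hq.1.le hq.2.le hm
  have h2 : 4 / ((1 - nomeRoot a ^ 2) ^ 2 * (a ^ 2 - 1)) * nomeRoot a ^ 2 = (a ^ 2 - 1) / (4 * a ^ 2) := by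
    have : 1 - nomeRoot a ^ 2 = 4 * a / (a + 1) ^ 2 := by
      rw [nomeRoot]; field_simp; ring
    rw [this, nomeRoot]
    have h5 : a - 1 ≠ 0 := by linarith
    have h6 : a + 1 ≠ 0 := by linarith
    have h7 : a ^ 2 - 1 = (a - 1) * (a + 1) := by ring
    rw [h7]
    field_simp
  calc _ ≤ 4 / ((1 - nomeRoot a ^ 2) ^ 2 * (a ^ 2 - 1)) * nomeRoot a ^ 2 := by gcongr
    _ = (a ^ 2 - 1) / (4 * a ^ 2) := h2
    _ < 1 / 4 := by rw [div_lt_div_iff₀ (by positivity) (by norm_num)]; linarith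

lemma summable_coeff (ha : 1 < a) (j : ℕ) : Summable fun n => |coeff a (2 * n + (j + 1))| := by
  have hq := nomeRoot_sq_mem ha
  have hg := summable_geometric_of_lt_one hq.1.le hq.2
  refine Summable.of_nonneg_of_le (fun _ => abs_nonneg _) (fun n => ?_)
    (hg.mul_left (4 / ((1 - nomeRoot a ^ 2) ^ 2 * (a ^ 2 - 1))))
  rw [abs_of_pos (coeff_pos ha (by omega))]
  refine (coeff_le ha (by omega)).trans ?_
  have h3 : 0 < a ^ 2 - 1 := by nlinarith
  refine mul_le_mul_of_nonneg_left ?_ (by positivity)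
  exact pow_le_pow_of_le_one hq.1.le hq.2.le (by omega)

lemma one_add_coeff_mul_sq_ne_zero (ha : 1 < a) {m : ℕ} (hm : m ≠ 0) {z : ℂ} (hz : z ∈ strip) :
    1 + (coeff a m : ℂ) * z ^ 2 ≠ 0 := by
  intro h
  have hre := congrArg Complex.re h
  have h1 := coeff_pos ha hm
  have h2 := coeff_lt ha hm
  have h3 : z.im ^ 2 < 4 := by
    have : |z.im| < 2 := hz
    have h4 := abs_lt.1 this
    nlinarith
  simp [pow_two] at hre
  nlinarith [mul_nonneg h1.le (sq_nonneg z.re)]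

/-- The factorisation on the boundary ellipse of a factor of the theta product. -/
lemma norm_factor_boundary (ha : 1 < a) (m : ℕ) (θ : ℝ) :
    ‖1 + (coeff a (m + 1) : ℂ) * boundaryPoint a θ ^ 2‖ =
      ((1 - (nomeRoot a ^ 2) ^ (m + 1)) ^ 2)⁻¹ *
        (‖1 + (nomeRoot a : ℂ) ^ (2 * m + 1) * Complex.exp (θ * Complex.I) ^ 2‖ *
        ‖1 + (nomeRoot a : ℂ) ^ (2 * m + 3) * Complex.exp (θ * Complex.I) ^ 2‖) := by
  set e := Complex.exp (θ * Complex.I) with he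
  set e' := Complex.exp (-(θ * Complex.I)) with he'
  have hee : e * e' = 1 := by rw [he, he', ← Complex.exp_add, add_neg_cancel, Complex.exp_zero]
  have hconj : starRingEnd ℂ e = e' := by
    rw [he, he', ← Complex.exp_conj]; simp
  have hz : boundaryPoint a θ = ((a + 1) * e + (a - 1) * e') / 2 := by
    rw [boundaryPoint, Complex.mk_eq_add_mul_I]
    push_cast
    rw [Complex.cos, Complex.sin, neg_mul, ← he, ← he']
    linear_combination (e - e') / 2 * Complex.I_sq * (-1)
  have hpos := one_sub_nome_pow_pos ha (Nat.succ_ne_zero m)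
  -- On the circle e⁻¹ is the conjugate of e, so replacing e by e⁻¹ in one factor leaves its modulus
  -- unchanged. After this replacement the factorisation is an algebraic identity between complex
  -- numbers, not only between moduli.
  have h1 : ‖1 + (nomeRoot a : ℂ) ^ (2 * m + 3) * e ^ 2‖ =
      ‖1 + (nomeRoot a : ℂ) ^ (2 * m + 3) * e' ^ 2‖ := by
    rw [← Complex.norm_conj]; simp [hconj]
  rw [h1, ← norm_mul, ← abs_of_pos (inv_pos.2 (pow_pos hpos 2)), ← Real.norm_eq_abs,
    ← Complex.norm_real, ← norm_mul]
  congr 1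
  have ha1 : (a : ℂ) + 1 ≠ 0 := by exact_mod_cast (by linarith : a + 1 ≠ 0)
  have ha2 : (a : ℂ) - 1 ≠ 0 := by exact_mod_cast (by linarith : a - 1 ≠ 0)
  set r : ℂ := (nomeRoot a : ℂ) with hr
  have hra : r * (a + 1) = a - 1 := by
    rw [hr, nomeRoot]; push_cast; field_simp
  have hr0 : r ≠ 0 := by
    rw [hr]; exact_mod_cast (nomeRoot_mem ha).1.ne'
  have hC : (1 : ℂ) - (r ^ 2) ^ (m + 1) ≠ 0 := by
    rw [hr]; exact_mod_cast hpos.ne'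
  have hz2 : 4 * boundaryPoint a θ ^ 2 / ((a : ℂ) ^ 2 - 1) = e ^ 2 / r + 2 + r * e' ^ 2 := by
    have h7 : (a : ℂ) ^ 2 - 1 = r * (a + 1) ^ 2 := by rw [pow_two (_ + _), ← mul_assoc, hra]; ring
    rw [hz, h7, ← hra]
    field_simp
    linear_combination 8 * r * hee
  have hcoeff : (coeff a (m + 1) : ℂ) * boundaryPoint a θ ^ 2 =
      (r ^ 2) ^ (m + 1) / (1 - (r ^ 2) ^ (m + 1)) ^ 2 *
        (4 * boundaryPoint a θ ^ 2 / ((a : ℂ) ^ 2 - 1)) := by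
    rw [coeff, hr]; push_cast
    rw [div_mul_eq_mul_div, div_mul_div_comm]
    congr 1; ring
  rw [hcoeff, hz2]
  push_cast
  rw [← hr]
  have hp : r ^ (2 * m + 1) = (r ^ 2) ^ (m + 1) / r := by
    rw [← pow_mul]; field_simp; ring
  have hp3 : r ^ (2 * m + 3) = (r ^ 2) ^ (m + 1) * r := by
    rw [← pow_mul]; ring
  rw [hp, hp3]
  set Q := (r ^ 2) ^ (m + 1)
  field_simp
  linear_combination -r * Q ^ 2 * (e * e' + 1) * hee

lemma norm_boundaryPoint (ha : 1 < a) (θ : ℝ) :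
    ‖boundaryPoint a θ‖ =
      (a + 1) / 2 * ‖1 + (nomeRoot a : ℂ) * Complex.exp (θ * Complex.I) ^ 2‖ := by
  set e := Complex.exp (θ * Complex.I) with he
  set e' := Complex.exp (-(θ * Complex.I)) with he'
  have hee : e * e' = 1 := by rw [he, he', ← Complex.exp_add, add_neg_cancel, Complex.exp_zero]
  have hz : boundaryPoint a θ = ((a + 1) * e + (a - 1) * e') / 2 := by
    rw [boundaryPoint, Complex.mk_eq_add_mul_I]
    push_cast
    rw [Complex.cos, Complex.sin, neg_mul, ← he, ← he']
    linear_combination (e - e') / 2 * Complex.I_sq * (-1)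
  have hconj : starRingEnd ℂ e = e' := by
    rw [he, he', ← Complex.exp_conj]; simp
  have ha1 : (a : ℂ) + 1 ≠ 0 := by exact_mod_cast (by linarith : a + 1 ≠ 0)
  have hra : (nomeRoot a : ℂ) * (a + 1) = a - 1 := by
    rw [nomeRoot]; push_cast; field_simp
  have hz' : boundaryPoint a θ = ((a + 1) / 2 : ℝ) * (e * (1 + nomeRoot a * e' ^ 2)) := by
    rw [hz, ← hra]; push_cast
    linear_combination (-(nomeRoot a : ℂ) * (a + 1) * e' / 2) * hee
  have hne : ‖e‖ = 1 := Complex.norm_exp_ofReal_mul_I θ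
  rw [hz', norm_mul, norm_mul, hne, one_mul, Complex.norm_real,
    Real.norm_of_nonneg (by linarith), ← Complex.norm_conj (1 + (nomeRoot a : ℂ) * e ^ 2)]
  simp [hconj]

end Coeff

/-! ### The conformal map of the ellipse -/

/-- The quotient of theta functions, as a function on the ellipse, up to normalisation. -/
def thetaQuotient (a : ℝ) (z : ℂ) : ℂ :=
  z * canonicalProd (fun n => coeff a (2 * n + 2)) (z ^ 2) /
    canonicalProd (fun n => coeff a (2 * n + 1)) (z ^ 2)

/-- The partial products of `thetaQuotient`. -/
def thetaQuotientPartial (a : ℝ) (N : ℕ) (z : ℂ) : ℂ :=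
  z * (∏ n ∈ Finset.range N, (1 + (coeff a (2 * n + 2) : ℂ) * z ^ 2)) /
    ∏ n ∈ Finset.range N, (1 + (coeff a (2 * n + 1) : ℂ) * z ^ 2)

/-- The modulus of a factor of the theta functions on the boundary ellipse. -/
def boundaryFactor (a θ : ℝ) (j : ℕ) : ℝ :=
  ‖1 + (nomeRoot a : ℂ) ^ j * Complex.exp (θ * Complex.I) ^ 2‖

section

variable {a : ℝ}

lemma boundaryFactor_pos (ha : 1 < a) (θ : ℝ) {j : ℕ} (hj : j ≠ 0) : 0 < boundaryFactor a θ j := by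
  refine norm_pos_iff.2 fun h => ?_
  have hr := nomeRoot_mem ha
  have h1 : ‖(nomeRoot a : ℂ) ^ j * Complex.exp (θ * Complex.I) ^ 2‖ = 1 := by
    rw [eq_neg_of_add_eq_zero_right h, norm_neg, norm_one]
  rw [norm_mul, norm_pow, norm_pow, Complex.norm_exp_ofReal_mul_I, Complex.norm_real,
    Real.norm_of_nonneg hr.1.le, one_pow, mul_one] at h1
  exact (pow_lt_one₀ hr.1.le hr.2 hj).ne h1

lemma boundaryFactor_tendsto (ha : 1 < a) (θ : ℝ) :
    Tendsto (fun N : ℕ => boundaryFactor a θ (4 * N + 1)) atTop (𝓝 1) := by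
  have hr := nomeRoot_mem ha
  have h1 : Tendsto (fun j : ℕ => (nomeRoot a : ℂ) ^ j) atTop (𝓝 0) :=
    tendsto_pow_atTop_nhds_zero_of_norm_lt_one (by
      rw [Complex.norm_real, Real.norm_of_nonneg hr.1.le]; exact hr.2)
  have h2 := (((h1.mul_const (Complex.exp (θ * Complex.I) ^ 2)).const_add 1).norm).comp
    (tendsto_atTop_mono (fun N : ℕ => (by omega : N ≤ 4 * N + 1)) tendsto_id)
  simpa [boundaryFactor, Function.comp_def] using h2

/-- Write B(j) for `boundaryFactor a θ j`. The n-th quotient of factors contributes B(4n + 5)/B(4n +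
1) up to a constant independent of θ, and |z| supplies B(1). The product telescopes to the single
term B(4N + 1). -/
lemma norm_thetaQuotientPartial (ha : 1 < a) (θ : ℝ) (N : ℕ) :
    ‖thetaQuotientPartial a N (boundaryPoint a θ)‖ =
      ((a + 1) / 2 * ∏ n ∈ Finset.range N, ((1 - (nomeRoot a ^ 2) ^ (2 * n + 1)) ^ 2 /
        (1 - (nomeRoot a ^ 2) ^ (2 * n + 2)) ^ 2)) * boundaryFactor a θ (4 * N + 1) := by
  induction N with
  | zero => simp [thetaQuotientPartial, norm_boundaryPoint ha, boundaryFactor]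
  | succ N ih =>
    have h1 : thetaQuotientPartial a (N + 1) (boundaryPoint a θ) =
        thetaQuotientPartial a N (boundaryPoint a θ) *
          ((1 + (coeff a (2 * N + 2) : ℂ) * boundaryPoint a θ ^ 2) /
          (1 + (coeff a (2 * N + 1) : ℂ) * boundaryPoint a θ ^ 2)) := by
      rw [thetaQuotientPartial, thetaQuotientPartial, Finset.prod_range_succ, Finset.prod_range_succ,
        ← mul_assoc, mul_div_mul_comm]
    have e1 := norm_factor_boundary ha (2 * N) θ
    have e2 := norm_factor_boundary ha (2 * N + 1) θ
    rw [show 2 * (2 * N) + 1 = 4 * N + 1 by ring, show 2 * (2 * N) + 3 = 4 * N + 3 by ring] at e1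
    rw [show 2 * (2 * N + 1) + 1 = 4 * N + 3 by ring, show 2 * (2 * N + 1) + 3 = 4 * (N + 1) + 1 by ring,
      show 2 * N + 1 + 1 = 2 * N + 2 by ring] at e2
    rw [h1, norm_mul, ih, norm_div, e1, e2, Finset.prod_range_succ]
    change _ * boundaryFactor a θ (4 * N + 1) *
      ((_ * (boundaryFactor a θ (4 * N + 3) * boundaryFactor a θ (4 * (N + 1) + 1))) /
      (_ * (boundaryFactor a θ (4 * N + 1) * boundaryFactor a θ (4 * N + 3)))) = _
    have p1 := boundaryFactor_pos ha θ (Nat.succ_ne_zero (4 * N))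
    have p2 := boundaryFactor_pos ha θ (Nat.succ_ne_zero (4 * N + 2))
    have p3 := one_sub_nome_pow_pos ha (Nat.succ_ne_zero (2 * N))
    have p4 := one_sub_nome_pow_pos ha (Nat.succ_ne_zero (2 * N + 1))
    simp only [Nat.succ_eq_add_one, add_assoc, Nat.reduceAdd] at p1 p2 p3 p4
    field_simp

lemma boundaryPoint_mem_strip (a θ : ℝ) : boundaryPoint a θ ∈ strip :=
  (abs_sin_le_one θ).trans_lt one_lt_two

lemma zero_mem_strip : (0 : ℂ) ∈ strip := by simp [strip]

lemma canonicalProd_coeff_ne_zero (ha : 1 < a) (j : ℕ) {z : ℂ} (hz : z ∈ strip) :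
    canonicalProd (fun n => coeff a (2 * n + (j + 1))) (z ^ 2) ≠ 0 :=
  canonicalProd_ne_zero (summable_coeff ha j) fun _ => one_add_coeff_mul_sq_ne_zero ha (by omega) hz

lemma thetaQuotientPartial_tendsto (ha : 1 < a) {z : ℂ} (hz : z ∈ strip) :
    Tendsto (fun N => thetaQuotientPartial a N z) atTop (𝓝 (thetaQuotient a z)) :=
  ((canonicalProd_tendsto (summable_coeff ha 1) _).const_mul z).div
    (canonicalProd_tendsto (summable_coeff ha 0) _) (canonicalProd_coeff_ne_zero ha 0 hz)

lemma norm_thetaQuotient_boundaryPoint (ha : 1 < a) (θ₁ θ₂ : ℝ) :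
    ‖thetaQuotient a (boundaryPoint a θ₁)‖ = ‖thetaQuotient a (boundaryPoint a θ₂)‖ := by
  -- Dividing the partial products by B(4N + 1) → 1 leaves a sequence independent of θ. Its
  -- convergence is inherited from the quotient, so its limit need not be known.
  have h : ∀ θ, Tendsto (fun N => (a + 1) / 2 * ∏ n ∈ Finset.range N,
      ((1 - (nomeRoot a ^ 2) ^ (2 * n + 1)) ^ 2 / (1 - (nomeRoot a ^ 2) ^ (2 * n + 2)) ^ 2)) atTop
      (𝓝 (‖thetaQuotient a (boundaryPoint a θ)‖ / 1)) := fun θ => by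
    refine Tendsto.congr (fun N => ?_) ((thetaQuotientPartial_tendsto ha
      (boundaryPoint_mem_strip a θ)).norm.div (boundaryFactor_tendsto ha θ) one_ne_zero)
    simp only [Pi.div_apply]
    rw [norm_thetaQuotientPartial ha, mul_div_cancel_right₀]
    exact (boundaryFactor_pos ha θ (by omega)).ne'
  simpa using tendsto_nhds_unique (h θ₁) (h θ₂)

lemma thetaQuotient_differentiableOn (ha : 1 < a) : DifferentiableOn ℂ (thetaQuotient a) strip := by
  have h : ∀ j, Differentiable ℂ
      fun z : ℂ => canonicalProd (fun n => coeff a (2 * n + (j + 1))) (z ^ 2) :=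
    fun j => (canonicalProd_differentiable (summable_coeff ha j)).comp (by fun_prop)
  exact ((differentiable_id.mul (h 1)).differentiableOn).div (h 0).differentiableOn
    fun z hz => canonicalProd_coeff_ne_zero ha 0 hz

lemma thetaQuotient_eq_zero (ha : 1 < a) {z : ℂ} (hz : z ∈ strip) (h : thetaQuotient a z = 0) :
    z = 0 := by
  rw [thetaQuotient, div_eq_zero_iff, mul_eq_zero] at h
  rcases h with (h | h) | h
  · exact h
  · exact absurd h (canonicalProd_coeff_ne_zero ha 1 hz)
  · exact absurd h (canonicalProd_coeff_ne_zero ha 0 hz)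

lemma hasDerivAt_thetaQuotient_zero (ha : 1 < a) : HasDerivAt (thetaQuotient a) 1 0 := by
  have h : ∀ j, DifferentiableAt ℂ
      (fun z : ℂ => canonicalProd (fun n => coeff a (2 * n + (j + 1))) (z ^ 2)) 0 :=
    fun j => ((canonicalProd_differentiable (summable_coeff ha j)).comp (by fun_prop)) 0
  have h0 : canonicalProd (fun n => coeff a (2 * n + (0 + 1))) (0 ^ 2) ≠ 0 :=
    canonicalProd_coeff_ne_zero ha 0 zero_mem_strip
  have h1 := ((hasDerivAt_id (0 : ℂ)).fun_mul (h 1).hasDerivAt).fun_div (h 0).hasDerivAt h0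
  simp only [id, canonicalProd_zero, zero_pow two_ne_zero] at h1
  norm_num at h1
  exact h1

end

/-- The properties of the normalised theta quotient by which it is identified as the conformal
map of the ellipse onto the disc. -/
structure IsEllipseMap (a : ℝ) (Φ : ℂ → ℂ) : Prop where
  differentiableOn : DifferentiableOn ℂ Φ strip
  norm_boundary : ∀ θ, ‖Φ (boundaryPoint a θ)‖ = 1
  odd : ∀ z, Φ (-z) = -Φ z
  map_conj : ∀ z, Φ (starRingEnd ℂ z) = starRingEnd ℂ (Φ z)
  deriv_zero : ∃ p : ℝ, 0 < p ∧ deriv Φ 0 = p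
  eq_zero : ∀ z ∈ strip, Φ z = 0 → z = 0

lemma exists_isEllipseMap {a : ℝ} (ha : 1 < a) : ∃ Φ, IsEllipseMap a Φ := by
  set M := ‖thetaQuotient a (boundaryPoint a 0)‖
  have hM : 0 < M := by
    refine norm_pos_iff.2 fun h => ?_
    have := congrArg Complex.re (thetaQuotient_eq_zero ha (boundaryPoint_mem_strip a 0) h)
    simp [boundaryPoint] at this
    linarith
  have hM' : (M : ℂ) ≠ 0 := by exact_mod_cast hM.ne'
  refine ⟨fun z => thetaQuotient a z / M, ?_, fun θ => ?_, fun z => ?_, fun z => ?_, ?_, ?_⟩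
  · exact (thetaQuotient_differentiableOn ha).div_const _
  · rw [norm_div, Complex.norm_real, Real.norm_of_nonneg hM.le,
      norm_thetaQuotient_boundaryPoint ha θ 0, div_self hM.ne']
  · simp [thetaQuotient, neg_div]
  · have h1 := canonicalProd_conj (summable_coeff ha 0) (z ^ 2)
    have h2 := canonicalProd_conj (summable_coeff ha 1) (z ^ 2)
    simp only [map_pow, zero_add, one_add_one_eq_two] at h1 h2
    simp [thetaQuotient, h1, h2]
  · refine ⟨M⁻¹, by positivity, ?_⟩
    rw [((hasDerivAt_thetaQuotient_zero ha).div_const _).deriv]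
    simp
  · intro z hz h
    exact thetaQuotient_eq_zero ha hz ((div_eq_zero_iff.1 h).resolve_right hM')

namespace IsEllipseMap

variable {a : ℝ} {Φ : ℂ → ℂ}

lemma apply_zero (h : IsEllipseMap a Φ) : Φ 0 = 0 := by
  have := h.odd 0
  rw [neg_zero] at this
  exact self_eq_neg.1 this

lemma norm_frontier (ha : 1 < a) (h : IsEllipseMap a Φ) {z : ℂ} (hz : z ∈ frontier (ellipse a)) :
    ‖Φ z‖ = 1 := by
  obtain ⟨θ, rfl⟩ := exists_boundaryPoint ha hz
  exact h.norm_boundary θ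

lemma ellipse_subset_strip (a : ℝ) : ellipse a ⊆ strip :=
  subset_closure.trans (closure_ellipse_subset_strip a)

lemma analyticAt (h : IsEllipseMap a Φ) {z : ℂ} (hz : z ∈ strip) : AnalyticAt ℂ Φ z :=
  h.differentiableOn.analyticAt (isOpen_strip.mem_nhds hz)

lemma isConformalOntoDisc (ha : 1 < a) (h : IsEllipseMap a Φ) :
    IsConformalOntoDisc (ellipse a) Φ := by
  have hd := h.differentiableOn.mono (ellipse_subset_strip a)
  obtain ⟨p, hp, hdp⟩ := h.deriv_zero
  refine ⟨hd, bijOn_ball_of_unimodular_frontier (isOpen_ellipse a) (isBounded_ellipse ha)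
    (isPreconnected_ellipse ha) hd
    (h.differentiableOn.continuousOn.mono (closure_ellipse_subset_strip a))
    (fun z hz => h.norm_frontier ha hz) (zero_mem_ellipse a) h.apply_zero ?_ fun z hz hz0 =>
      h.eq_zero z (ellipse_subset_strip a hz) hz0⟩
  rw [hdp]
  exact_mod_cast hp.ne'

lemma deriv_ne_zero (ha : 1 < a) (h : IsEllipseMap a Φ) {z : ℂ} (hz : z ∈ ellipse a) :
    deriv Φ z ≠ 0 :=
  deriv_ne_zero_of_injOn ((isOpen_ellipse a).mem_nhds hz)
    (h.analyticAt (ellipse_subset_strip a hz)) (h.isConformalOntoDisc ha).2.injOn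

/-- The second derivative of the odd function `Φ` vanishes at `0`. -/
lemma deriv_deriv_zero (h : IsEllipseMap a Φ) : deriv (deriv Φ) 0 = 0 := by
  have h1 : ∀ z, deriv Φ (-z) = deriv Φ z := fun z => by
    have h2 : Φ = fun w => -Φ (-w) := by funext w; rw [h.odd, neg_neg]
    conv_rhs => rw [h2]
    rw [deriv.fun_neg, deriv_comp_neg, neg_neg]
  have h3 : deriv Φ = fun w => deriv Φ (-w) := by funext w; rw [h1]
  have h4 : deriv (deriv Φ) 0 = -deriv (deriv Φ) 0 := by
    conv_lhs => rw [h3]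
    rw [deriv_comp_neg, neg_zero]
  exact self_eq_neg.1 h4

end IsEllipseMap

/-! ### Holomorphic functions that are real on the boundary -/

lemma exists_real_const_of_real_frontier {U : Set ℂ} {R : ℂ → ℂ} (hUo : IsOpen U)
    (hUb : Bornology.IsBounded U) (hUc : IsPreconnected U) (hR : DiffContOnCl ℂ R U)
    (hre : ∀ z ∈ frontier U, (R z).im = 0) : ∃ r : ℝ, ∀ z ∈ U, R z = r := by
  have him : ∀ z ∈ U, (R z).im = 0 := by
    intro z hz
    -- The hypothesis on ε encodes an implication: where R is real, εR is purely imaginary. It is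
    -- used for ε = ±i, so the maximum principle for exp(±iR) bounds Im R on both sides.
    have key : ∀ ε : ℂ, (∀ w, (ε * R w).re = 0 ∨ (R w).im ≠ 0) → (ε * R z).re ≤ 0 := by
      intro ε hε
      have hd : DiffContOnCl ℂ (fun w => Complex.exp (ε * R w)) U :=
        Complex.differentiable_exp.comp_diffContOnCl (hR.const_smul ε)
      have h := Complex.norm_le_of_forall_mem_frontier_norm_le hUb hd (C := 1) (fun w hw => by
        rw [Complex.norm_exp, (hε w).resolve_right (not_not.2 (hre w hw)), Real.exp_zero])
        (subset_closure hz)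
      rwa [Complex.norm_exp, Real.exp_le_one_iff] at h
    have h1 := key Complex.I fun w => by simp [em]
    have h2 := key (-Complex.I) fun w => by simp [em]
    simp at h1 h2
    linarith
  rcases U.eq_empty_or_nonempty with rfl | ⟨z₀, hz₀⟩
  · exact ⟨0, fun z hz => absurd hz (notMem_empty z)⟩
  · refine ⟨(R z₀).re, fun z hz => ?_⟩
    have han : AnalyticOnNhd ℂ R U := fun w hw => hR.differentiableOn.analyticAt (hUo.mem_nhds hw)
    have hc : R z = R z₀ := by
      rcases han.is_constant_or_isOpen hUc with ⟨w, hw⟩ | hopen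
      · rw [hw z hz, hw z₀ hz₀]
      · exfalso
        have ho := hopen U subset_rfl hUo
        obtain ⟨ε, hε, hball⟩ := Metric.isOpen_iff.1 ho (R z₀) (mem_image_of_mem R hz₀)
        have hmem : R z₀ + ((ε / 2 : ℝ) : ℂ) * Complex.I ∈ Metric.ball (R z₀) ε := by
          rw [Metric.mem_ball, dist_eq_norm, add_sub_cancel_left, norm_mul, Complex.norm_I, mul_one,
            Complex.norm_real, Real.norm_of_nonneg (by positivity)]
          linarith
        obtain ⟨x, hx, hxe⟩ := hball hmem
        have := congrArg Complex.im hxe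
        simp [him x hx, him z₀ hz₀] at this
        linarith
    rw [hc]
    exact Complex.ext (by simp) (by simp [him z₀ hz₀])

/-! ### The differential equation -/

/-- The linear eccentricity of the ellipse. -/
def focus (a : ℝ) : ℝ := √(a ^ 2 - 1)

lemma focus_sq {a : ℝ} (ha : 1 < a) : focus a ^ 2 = a ^ 2 - 1 := sq_sqrt (by nlinarith)

lemma focus_pos {a : ℝ} (ha : 1 < a) : 0 < focus a := sqrt_pos.2 (by nlinarith)

lemma ofReal_mem_ellipse {a x : ℝ} (ha : 1 < a) (hx : |x| ≤ focus a) : (x : ℂ) ∈ ellipse a := by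
  have h1 : x ^ 2 ≤ focus a ^ 2 := sq_le_sq.2 (by rwa [abs_of_pos (focus_pos ha)])
  rw [focus_sq ha] at h1
  simp only [ellipse, mem_ofPred_eq, Complex.ofReal_re, Complex.ofReal_im]
  rw [zero_pow two_ne_zero, add_zero, div_lt_one (by positivity)]
  linarith

lemma hasDerivAt_boundaryPoint (a θ : ℝ) :
    HasDerivAt (boundaryPoint a) (⟨-(a * Real.sin θ), Real.cos θ⟩ : ℂ) θ := by
  have h : boundaryPoint a =
      fun t => ((a * Real.cos t : ℝ) : ℂ) + ((Real.sin t : ℝ) : ℂ) * Complex.I := by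
    funext t; rw [boundaryPoint, Complex.mk_eq_add_mul_I]
  rw [h, Complex.mk_eq_add_mul_I]
  refine HasDerivAt.add (HasDerivAt.ofReal_comp ?_)
    ((HasDerivAt.ofReal_comp (Real.hasDerivAt_sin θ)).mul_const _)
  simpa using (Real.hasDerivAt_cos θ).const_mul a

namespace IsEllipseMap

variable {a : ℝ} {Φ : ℂ → ℂ}

lemma im_ofReal (h : IsEllipseMap a Φ) (x : ℝ) : (Φ x).im = 0 := by
  have := h.map_conj x
  rw [Complex.conj_ofReal] at this
  exact Complex.conj_eq_iff_im.1 this.symm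

/-- The value of the conformal map at the focus. -/
def focalValue (a : ℝ) (Φ : ℂ → ℂ) : ℝ := (Φ (focus a)).re

lemma apply_focus (h : IsEllipseMap a Φ) : Φ (focus a) = focalValue a Φ :=
  Complex.ext (by simp [focalValue]) (by simp [h.im_ofReal])

lemma apply_neg_focus (h : IsEllipseMap a Φ) : Φ (-focus a) = -focalValue a Φ := by
  rw [h.odd, h.apply_focus]

lemma norm_lt_one (ha : 1 < a) (h : IsEllipseMap a Φ) {z : ℂ} (hz : z ∈ ellipse a) : ‖Φ z‖ < 1 :=
  mem_ball_zero_iff.1 ((h.isConformalOntoDisc ha).2.mapsTo hz)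

lemma focus_mem_ellipse (ha : 1 < a) : (focus a : ℂ) ∈ ellipse a :=
  ofReal_mem_ellipse ha (abs_of_pos (focus_pos ha)).le

lemma neg_focus_mem_ellipse (ha : 1 < a) : (-focus a : ℂ) ∈ ellipse a := by
  have := ofReal_mem_ellipse ha (x := -focus a) (by rw [abs_neg, abs_of_pos (focus_pos ha)])
  simpa using this

lemma focalValue_sq_lt_one (ha : 1 < a) (h : IsEllipseMap a Φ) : focalValue a Φ ^ 2 < 1 := by
  have h1 := h.norm_lt_one ha (focus_mem_ellipse ha)
  rw [h.apply_focus, Complex.norm_real, Real.norm_eq_abs] at h1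
  exact (sq_lt_one_iff_abs_lt_one _).2 h1

lemma dslope_ne_zero (ha : 1 < a) (h : IsEllipseMap a Φ) {w z : ℂ} (hw : w ∈ ellipse a)
    (hz : z ∈ closure (ellipse a)) : dslope Φ w z ≠ 0 := by
  by_cases hwz : z = w
  · rw [hwz, dslope_same]; exact h.deriv_ne_zero ha hw
  · rw [dslope_of_ne _ hwz, slope_def_field]
    refine div_ne_zero (fun h0 => ?_) (sub_ne_zero.2 hwz)
    have h1 : Φ z = Φ w := sub_eq_zero.1 h0
    by_cases hzU : z ∈ ellipse a
    · exact hwz ((h.isConformalOntoDisc ha).2.injOn hzU hw h1)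
    · have h2 := h.norm_frontier ha (by rw [(isOpen_ellipse a).frontier_eq]; exact ⟨hz, hzU⟩)
      rw [h1] at h2
      exact (h.norm_lt_one ha hw).ne h2

lemma norm_le_one (ha : 1 < a) (h : IsEllipseMap a Φ) {z : ℂ} (hz : z ∈ closure (ellipse a)) :
    ‖Φ z‖ ≤ 1 := by
  by_cases hzU : z ∈ ellipse a
  · exact (h.norm_lt_one ha hzU).le
  · exact (h.norm_frontier ha (by rw [(isOpen_ellipse a).frontier_eq]; exact ⟨hz, hzU⟩)).le

lemma one_sub_focalValue_ne_zero (ha : 1 < a) (h : IsEllipseMap a Φ) {u : ℂ} (hu : ‖u‖ ≤ 1) :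
    1 - (focalValue a Φ : ℂ) ^ 2 * u ^ 2 ≠ 0 := by
  intro h0
  have h1 : ‖(focalValue a Φ : ℂ) ^ 2 * u ^ 2‖ = 1 := by rw [← sub_eq_zero.1 h0, norm_one]
  rw [norm_mul, norm_pow, norm_pow, Complex.norm_real, Real.norm_eq_abs, sq_abs] at h1
  have h2 := h.focalValue_sq_lt_one ha
  have h3 : ‖u‖ ^ 2 ≤ 1 := pow_le_one₀ (norm_nonneg _) hu
  nlinarith [sq_nonneg (focalValue a Φ)]

/-- Here v is tangent to the unit circle at u, so v = i t u with t real, and κ - u² = -u² times the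
conjugate of 1 - κu². Both sides of the equation are then -u² times a real number, up to the factor
r. -/
lemma boundary_reality {u v r : ℂ} {κ : ℝ} (hu : ‖u‖ = 1)
    (huv : (starRingEnd ℂ u * v).re = 0) (hk : 1 - (κ : ℂ) * u ^ 2 ≠ 0)
    (h : v ^ 2 = r * ((κ - u ^ 2) * (1 - κ * u ^ 2))) : r.im = 0 := by
  have huu : u * starRingEnd ℂ u = 1 := by
    rw [Complex.mul_conj, Complex.normSq_eq_norm_sq, hu]; norm_num
  set t := (starRingEnd ℂ u * v).im with ht
  have hit : starRingEnd ℂ u * v = t * Complex.I :=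
    Complex.ext (by simp [huv]) (by simp [ht])
  have hv : v = t * Complex.I * u := by
    rw [← hit]; linear_combination -v * huu
  have hu0 : u ≠ 0 := norm_pos_iff.1 (by rw [hu]; exact one_pos)
  have hN : (1 - (κ : ℂ) * u ^ 2) * starRingEnd ℂ (1 - (κ : ℂ) * u ^ 2) =
      (Complex.normSq (1 - (κ : ℂ) * u ^ 2) : ℂ) := Complex.mul_conj _
  have hconj : starRingEnd ℂ (1 - (κ : ℂ) * u ^ 2) = 1 - κ * (starRingEnd ℂ u) ^ 2 := by simp
  rw [hconj] at hN
  have hN0 : (Complex.normSq (1 - (κ : ℂ) * u ^ 2) : ℂ) ≠ 0 := by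
    exact_mod_cast (Complex.normSq_pos.2 hk).ne'
  have h2 : (κ : ℂ) - u ^ 2 = -u ^ 2 * (1 - κ * (starRingEnd ℂ u) ^ 2) := by
    linear_combination (-(κ : ℂ)) * (u * starRingEnd ℂ u + 1) * huu
  have h3 : r * (Complex.normSq (1 - (κ : ℂ) * u ^ 2) : ℂ) = ((t ^ 2 : ℝ) : ℂ) := by
    rw [← hN]
    refine mul_left_cancel₀ (pow_ne_zero 2 hu0) ?_
    rw [hv, h2] at h
    push_cast
    linear_combination h - (t : ℂ) ^ 2 * u ^ 2 * Complex.I_sq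
  have h4 : r = ((t ^ 2 / Complex.normSq (1 - (κ : ℂ) * u ^ 2) : ℝ) : ℂ) := by
    rw [Complex.ofReal_div, ← h3, mul_div_cancel_right₀ _ hN0]
  rw [h4, Complex.ofReal_im]

/-- The conformal map of the ellipse satisfies the differential equation of `√k sn`. -/
lemma exists_ode (ha : 1 < a) (h : IsEllipseMap a Φ) :
    ∃ r : ℝ, ∀ z ∈ ellipse a, deriv Φ z ^ 2 * ((focus a : ℂ) ^ 2 - z ^ 2) =
      r * (((focalValue a Φ : ℂ) ^ 2 - Φ z ^ 2) * (1 - (focalValue a Φ : ℂ) ^ 2 * Φ z ^ 2)) := by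
  set σ := focalValue a Φ with hσ
  set c : ℂ := (focus a : ℂ) with hc
  -- The two difference quotients are (Φ - σ)/(z - c) and (Φ + σ)/(z + c). Using them cancels the
  -- zeros at ±c in advance, so R has no singularity at the foci.
  set N : ℂ → ℂ := fun z => dslope Φ c z * dslope Φ (-c) z * (1 - (σ : ℂ) ^ 2 * Φ z ^ 2) with hN
  set R : ℂ → ℂ := fun z => deriv Φ z ^ 2 / N z with hR
  have hcE : c ∈ ellipse a := focus_mem_ellipse ha
  have hcE' : -c ∈ ellipse a := neg_focus_mem_ellipse ha
  have hN0 : ∀ z ∈ closure (ellipse a), N z ≠ 0 := fun z hz =>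
    mul_ne_zero (mul_ne_zero (h.dslope_ne_zero ha hcE hz) (h.dslope_ne_zero ha hcE' hz))
      (h.one_sub_focalValue_ne_zero ha (h.norm_le_one ha hz))
  have hstrip : ∀ z ∈ ellipse a, strip ∈ 𝓝 z := fun z hz =>
    isOpen_strip.mem_nhds (ellipse_subset_strip a hz)
  have hNd : DifferentiableOn ℂ N strip :=
    (((Complex.differentiableOn_dslope (hstrip c hcE)).2 h.differentiableOn).mul
      ((Complex.differentiableOn_dslope (hstrip (-c) hcE')).2 h.differentiableOn)).mul
      ((differentiableOn_const _).sub ((differentiableOn_const _).mul (h.differentiableOn.pow 2)))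
  have hDd : DifferentiableOn ℂ (fun z => deriv Φ z ^ 2) strip :=
    (h.differentiableOn.deriv isOpen_strip).pow 2
  have hRd : DiffContOnCl ℂ R (ellipse a) :=
    ⟨(hDd.mono (ellipse_subset_strip a)).div (hNd.mono (ellipse_subset_strip a))
      fun z hz => hN0 z (subset_closure hz),
      (hDd.continuousOn.mono (closure_ellipse_subset_strip a)).div
      (hNd.continuousOn.mono (closure_ellipse_subset_strip a)) hN0⟩
  have hode : ∀ z ∈ closure (ellipse a), deriv Φ z ^ 2 * (c ^ 2 - z ^ 2) =
      R z * (((σ : ℂ) ^ 2 - Φ z ^ 2) * (1 - (σ : ℂ) ^ 2 * Φ z ^ 2)) := by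
    intro z hz
    have h1 : (z - c) * dslope Φ c z = Φ z - σ := by
      have := sub_smul_dslope Φ c z
      rwa [smul_eq_mul, h.apply_focus] at this
    have h2 : (z + c) * dslope Φ (-c) z = Φ z + σ := by
      have := sub_smul_dslope Φ (-c) z
      rwa [smul_eq_mul, h.apply_neg_focus, sub_neg_eq_add, sub_neg_eq_add] at this
    have h3 : R z * N z = deriv Φ z ^ 2 := div_mul_cancel₀ _ (hN0 z hz)
    have h4 : (σ : ℂ) ^ 2 - Φ z ^ 2 = (c ^ 2 - z ^ 2) * (dslope Φ c z * dslope Φ (-c) z) := by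
      linear_combination (Φ z + σ) * h1 + (z - c) * dslope Φ c z * h2
    rw [← h3, h4]
    simp only [hN]
    ring
  obtain ⟨r, hr⟩ := exists_real_const_of_real_frontier (isOpen_ellipse a) (isBounded_ellipse ha)
    (isPreconnected_ellipse ha) hRd (fun z hz => by
      have hzc := frontier_subset_closure hz
      obtain ⟨θ, rfl⟩ := exists_boundaryPoint ha hz
      set b' : ℂ := ⟨-(a * Real.sin θ), Real.cos θ⟩ with hb'
      have hΦd : HasDerivAt Φ (deriv Φ (boundaryPoint a θ)) (boundaryPoint a θ) :=
        (h.analyticAt (boundaryPoint_mem_strip a θ)).differentiableAt.hasDerivAt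
      have hcomp : HasDerivAt (fun t => Φ (boundaryPoint a t))
          (deriv Φ (boundaryPoint a θ) * b') θ := hΦd.comp θ (hasDerivAt_boundaryPoint a θ)
      -- Differentiating |Φ|² = 1 along the ellipse makes Φ' b' tangent to the circle. Since b'² =
      -- c² - z² for the eccentric anomaly, (Φ' b')² is the left side of the equation.
      have hsq := hcomp.norm_sq
      simp only [h.norm_boundary] at hsq
      have hinner := hsq.unique (hasDerivAt_const θ _)
      rw [Complex.inner] at hinner
      refine boundary_reality (κ := σ ^ 2) (v := deriv Φ (boundaryPoint a θ) * b')
        (h.norm_boundary θ) (by rw [mul_comm]; linarith) ?_ ?_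
      · have := h.one_sub_focalValue_ne_zero ha (h.norm_boundary θ).le
        simpa using this
      · have hb2 : b' ^ 2 = c ^ 2 - boundaryPoint a θ ^ 2 := by
          have hc2 : c ^ 2 = (a : ℂ) ^ 2 - 1 := by
            rw [hc]; exact_mod_cast congrArg (Complex.ofReal) (focus_sq ha)
          have hcs : (Real.cos θ : ℂ) ^ 2 + (Real.sin θ : ℂ) ^ 2 = 1 := by
            exact_mod_cast congrArg Complex.ofReal (Real.cos_sq_add_sin_sq θ)
          rw [hc2, hb', boundaryPoint, Complex.mk_eq_add_mul_I, Complex.mk_eq_add_mul_I,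
            Complex.ofReal_neg, Complex.ofReal_mul, Complex.ofReal_mul]
          linear_combination ((a : ℂ) ^ 2 - 1) * hcs +
            ((Real.cos θ : ℂ) ^ 2 + (Real.sin θ : ℂ) ^ 2) * Complex.I_sq
        have := hode _ hzc
        rw [mul_pow, hb2, this, Complex.ofReal_pow])
  exact ⟨r, fun z hz => by rw [hode z (subset_closure hz), hr z hz]⟩

end IsEllipseMap

/-! ### Incomplete elliptic integrals -/

/-- The incomplete elliptic integral of the first kind. -/
def ellipticF (m φ : ℝ) : ℝ := ∫ t in (0 : ℝ)..φ, 1 / √(1 - m ^ 2 * sin t ^ 2)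

lemma ellipticF_pi_div_two (m : ℝ) : ellipticF m (π / 2) = ellipticK m := rfl

lemma ellipticF_zero (m : ℝ) : ellipticF m 0 = 0 := by simp [ellipticF]

lemma hasDerivAt_ellipticF {m : ℝ} (h0 : 0 ≤ m) (h1 : m < 1) (φ : ℝ) :
    HasDerivAt (ellipticF m) (1 / √(1 - m ^ 2 * sin φ ^ 2)) φ :=
  ((ellipticK_integrand_continuous h0 h1).integral_hasStrictDerivAt 0 φ).hasDerivAt

lemma continuous_ellipticF {m : ℝ} (h0 : 0 ≤ m) (h1 : m < 1) : Continuous (ellipticF m) :=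
  continuous_iff_continuousAt.2 fun φ => (hasDerivAt_ellipticF h0 h1 φ).continuousAt

/-- The right endpoint needs only continuity. This matters for `arcsin (x / c)`, which is not
differentiable at x = c. -/
lemma eq_of_hasDerivAt_eq {f g f' : ℝ → ℝ} {b : ℝ} (hb : 0 ≤ b) (hf : ContinuousOn f (Icc 0 b))
    (hg : ContinuousOn g (Icc 0 b)) (hfd : ∀ x ∈ Ico 0 b, HasDerivAt f (f' x) x)
    (hgd : ∀ x ∈ Ico 0 b, HasDerivAt g (f' x) x) (h0 : f 0 = g 0) : f b = g b := by
  have h := constant_of_has_deriv_right_zero (hf.sub hg) (fun x hx => by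
    have := ((hfd x hx).sub (hgd x hx)).hasDerivWithinAt (s := Ici x)
    rwa [sub_self] at this) b ⟨hb, le_rfl⟩
  simp only [Pi.sub_apply, h0, sub_self] at h
  linarith

lemma strictMonoOn_of_hasDerivAt_pos {s s' : ℝ → ℝ} {b : ℝ} (hcont : ContinuousOn s (Icc 0 b))
    (hd : ∀ x ∈ Ico 0 b, HasDerivAt s (s' x) x) (hpos : ∀ x ∈ Ico 0 b, 0 < s' x) :
    StrictMonoOn s (Icc 0 b) := by
  refine strictMonoOn_of_deriv_pos (convex_Icc 0 b) hcont fun x hx => ?_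
  rw [interior_Icc] at hx
  rw [(hd x (Ioo_subset_Ico_self hx)).deriv]
  exact hpos x (Ioo_subset_Ico_self hx)

/-- The quarter period from a solution of the differential equation of `√k sn` on the real axis. -/
lemma ellipticK_of_ode {s s' : ℝ → ℝ} {c σ r : ℝ} (hc : 0 < c) (hσ : 0 < σ) (hσ1 : σ ^ 2 < 1)
    (hr : 0 ≤ r)
    (hcont : ContinuousOn s (Icc 0 c)) (hd : ∀ x ∈ Ico 0 c, HasDerivAt s (s' x) x)
    (hpos : ∀ x ∈ Ico 0 c, 0 < s' x) (hs0 : s 0 = 0) (hsc : s c = σ)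
    (hode : ∀ x ∈ Ico 0 c, s' x ^ 2 * (c ^ 2 - x ^ 2) =
      r * ((σ ^ 2 - s x ^ 2) * (1 - σ ^ 2 * s x ^ 2))) :
    ellipticK (σ ^ 2) = √r * (π / 2) := by
  have hσ2 : 0 ≤ σ ^ 2 := sq_nonneg σ
  have hmono := strictMonoOn_of_hasDerivAt_pos hcont hd hpos
  have hbound : ∀ x ∈ Ico 0 c, 0 ≤ s x ∧ s x < σ := fun x hx => by
    constructor
    · rw [← hs0]
      exact hmono.monotoneOn ⟨le_rfl, hc.le⟩ (Ico_subset_Icc_self hx) hx.1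
    · rw [← hsc]
      exact hmono (Ico_subset_Icc_self hx) ⟨hc.le, le_rfl⟩ hx.2
  have key := eq_of_hasDerivAt_eq (f := fun x => ellipticF (σ ^ 2) (arcsin (s x / σ)))
    (g := fun x => √r * arcsin (x / c))
    (f' := fun x => √r * (1 / √(1 - (x / c) ^ 2) * (1 / c))) hc.le
    ((continuous_ellipticF hσ2 hσ1).comp_continuousOn
      (continuous_arcsin.comp_continuousOn (hcont.div_const σ)))
    (by fun_prop) (fun x hx => ?_) (fun x hx => ?_) (by simp [hs0, ellipticF_zero])
  · simpa [hsc, div_self hσ.ne', div_self hc.ne', arcsin_one, ellipticF_pi_div_two] using key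
  · obtain ⟨h0, h1⟩ := hbound x hx
    have hS1 : s x / σ < 1 := (div_lt_one hσ).2 h1
    have hS0 : 0 ≤ s x / σ := div_nonneg h0 hσ.le
    have hX1 : x / c < 1 := (div_lt_one hc).2 hx.2
    have hX0 : 0 ≤ x / c := div_nonneg hx.1 hc.le
    have hder := (hasDerivAt_ellipticF hσ2 hσ1 (arcsin (s x / σ))).comp x
      ((Real.hasDerivAt_arcsin (by linarith) hS1.ne).comp x ((hd x hx).div_const σ))
    refine hder.congr_deriv ?_
    rw [sin_arcsin (by linarith) hS1.le]
    have hs' := hpos x hx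
    have p1 : 0 < 1 - σ ^ 2 * s x ^ 2 := by nlinarith [sq_nonneg (s x)]
    have p2 : 0 < σ ^ 2 - s x ^ 2 := by nlinarith
    have p3 : 0 < c ^ 2 - x ^ 2 := by nlinarith [hx.1, hx.2]
    have e1 : 1 - (σ ^ 2) ^ 2 * (s x / σ) ^ 2 = 1 - σ ^ 2 * s x ^ 2 := by field_simp
    have e2 : 1 - (s x / σ) ^ 2 = (σ ^ 2 - s x ^ 2) / σ ^ 2 := by field_simp
    have e3 : 1 - (x / c) ^ 2 = (c ^ 2 - x ^ 2) / c ^ 2 := by field_simp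
    rw [e1, e2, e3]
    refine (pow_left_inj₀ (by positivity) (by positivity) two_ne_zero).1 ?_
    simp only [mul_pow, div_pow, one_pow, sq_sqrt p1.le, sq_sqrt hr,
      sq_sqrt (div_pos p2 (pow_pos hσ 2)).le, sq_sqrt (div_pos p3 (pow_pos hc 2)).le]
    have q1 := p1.ne'
    have q2 := p2.ne'
    have q3 := p3.ne'
    have hx2 := hode x hx
    field_simp
    linear_combination hx2
  · have hX1 : x / c < 1 := (div_lt_one hc).2 hx.2
    have hX0 : 0 ≤ x / c := div_nonneg hx.1 hc.le
    exact ((Real.hasDerivAt_arcsin (by linarith) hX1.ne).comp x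
      ((hasDerivAt_id x).div_const c)).const_mul _

lemma one_sub_sq_mul_sin_arctan_sq {k : ℝ} (hk : k ^ 2 ≤ 1) (τ : ℝ) :
    1 - √(1 - k ^ 2) ^ 2 * sin (arctan τ) ^ 2 = (1 + k ^ 2 * τ ^ 2) / (1 + τ ^ 2) := by
  have h : 0 < 1 + τ ^ 2 := by positivity
  rw [sq_sqrt (by linarith), sin_arctan, div_pow, sq_sqrt h.le]
  field_simp
  ring

/-- The half period from a solution of the differential equation on the imaginary axis. -/
lemma ellipticF_arctan_of_ode {t t' : ℝ → ℝ} {c σ r b : ℝ} (hc : 0 < c) (hσ : 0 < σ)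
    (hσ1 : σ ^ 2 < 1) (hb : 0 ≤ b) (hr : 0 ≤ r)
    (hcont : ContinuousOn t (Icc 0 b)) (hd : ∀ x ∈ Ico 0 b, HasDerivAt t (t' x) x)
    (hpos : ∀ x ∈ Ico 0 b, 0 < t' x) (ht0 : t 0 = 0)
    (hode : ∀ x ∈ Ico 0 b, t' x ^ 2 * (c ^ 2 + x ^ 2) =
      r * ((σ ^ 2 + t x ^ 2) * (1 + σ ^ 2 * t x ^ 2))) :
    ellipticF √(1 - (σ ^ 2) ^ 2) (arctan (t b / σ)) = √r * arsinh (b / c) := by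
  have hm := sqrt_one_sub_sq_mem (x := σ ^ 2) ⟨by positivity, hσ1⟩
  refine eq_of_hasDerivAt_eq (f := fun x => ellipticF √(1 - (σ ^ 2) ^ 2) (arctan (t x / σ)))
    (g := fun x => √r * arsinh (x / c))
    (f' := fun x => √r * ((√(1 + (x / c) ^ 2))⁻¹ * (1 / c))) hb
    ((continuous_ellipticF hm.1.le hm.2).comp_continuousOn
      (continuous_arctan.comp_continuousOn (hcont.div_const σ)))
    (continuous_const.mul (continuous_arsinh.comp (by fun_prop))).continuousOn
    (fun x hx => ?_) (fun x hx => ?_) (by simp [ht0, ellipticF_zero])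
  · have hder := (hasDerivAt_ellipticF hm.1.le hm.2 (arctan (t x / σ))).comp x
      ((Real.hasDerivAt_arctan (t x / σ)).comp x ((hd x hx).div_const σ))
    refine hder.congr_deriv ?_
    have ht' := hpos x hx
    rw [one_sub_sq_mul_sin_arctan_sq (by nlinarith [sq_nonneg σ])]
    have p1 : 0 ≤ (1 + (σ ^ 2) ^ 2 * (t x / σ) ^ 2) / (1 + (t x / σ) ^ 2) := by positivity
    have p3 : 0 ≤ 1 + (x / c) ^ 2 := by positivity
    refine (pow_left_inj₀ (by positivity) (by positivity) two_ne_zero).1 ?_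
    simp only [mul_pow, div_pow, one_pow, inv_pow, sq_sqrt hr]
    rw [sq_sqrt (by positivity), sq_sqrt (by positivity)]
    have hx2 := hode x hx
    have q1 : σ ^ 2 + t x ^ 2 ≠ 0 := by positivity
    have q2 : 1 + σ ^ 2 * t x ^ 2 ≠ 0 := by positivity
    have q3 : c ^ 2 + x ^ 2 ≠ 0 := by positivity
    have e1 : 1 + (σ ^ 2) ^ 2 * (t x ^ 2 / σ ^ 2) = 1 + σ ^ 2 * t x ^ 2 := by field_simp
    have e2 : 1 + t x ^ 2 / σ ^ 2 = (σ ^ 2 + t x ^ 2) / σ ^ 2 := by field_simp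
    have e3 : 1 + x ^ 2 / c ^ 2 = (c ^ 2 + x ^ 2) / c ^ 2 := by field_simp
    rw [e1, e2, e3]
    field_simp
    linear_combination hx2
  · exact ((Real.hasDerivAt_arsinh (x / c)).comp x ((hasDerivAt_id x).div_const c)).const_mul _

/-- The point `arctan (1 / √k)` halves the complete integral with the complementary modulus. -/
lemma two_mul_ellipticF_half {σ : ℝ} (hσ : 0 < σ) (hσ1 : σ ^ 2 < 1) :
    2 * ellipticF √(1 - (σ ^ 2) ^ 2) (arctan (1 / σ)) = ellipticK √(1 - (σ ^ 2) ^ 2) := by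
  set k := σ ^ 2 with hk
  have hk0 : 0 < k := by positivity
  have hm := sqrt_one_sub_sq_mem (x := k) ⟨hk0, hσ1⟩
  have hcE := continuous_ellipticF hm.1.le hm.2
  set m := √(1 - k ^ 2) with hmdef
  have hk2 : k ^ 2 ≤ 1 := by nlinarith
  -- The substitution τ ↦ 1/(kτ), in angles arctan τ ↦ π/2 - arctan(kτ), reverses the integration
  -- and preserves the integrand. Its fixed point τ = 1/√k = 1/σ is therefore the midpoint of the
  -- integral.
  have key := eq_of_hasDerivAt_eq (b := 1 / σ)
    (f := fun τ => ellipticF m (arctan τ))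
    (g := fun τ => ellipticF m (π / 2) - ellipticF m (π / 2 - arctan (k * τ)))
    (f' := fun τ => 1 / √((1 + k ^ 2 * τ ^ 2) / (1 + τ ^ 2)) * (1 / (1 + τ ^ 2)))
    (by positivity) (by fun_prop) (by fun_prop) (fun τ _ => ?_) (fun τ _ => ?_)
    (by simp [ellipticF_zero])
  · have h1 : k * (1 / σ) = σ := by rw [hk]; field_simp
    have h2 : π / 2 - arctan σ = arctan (1 / σ) := by
      rw [one_div, arctan_inv_of_pos hσ]
    simp only [h1, h2] at key
    rw [← ellipticF_pi_div_two]
    linarith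
  · have := (hasDerivAt_ellipticF hm.1.le hm.2 (arctan τ)).comp τ (Real.hasDerivAt_arctan τ)
    rwa [hmdef, one_sub_sq_mul_sin_arctan_sq hk2] at this
  · have h1 := (hasDerivAt_ellipticF hm.1.le hm.2 (π / 2 - arctan (k * τ))).comp τ
      (((Real.hasDerivAt_arctan (k * τ)).comp τ ((hasDerivAt_id τ).const_mul k)).const_sub (π / 2))
    have h2 := h1.const_sub (ellipticF m (π / 2))
    refine h2.congr_deriv ?_
    have hp : 0 < 1 + (k * τ) ^ 2 := by positivity
    have h3 : 1 - m ^ 2 * sin (π / 2 - arctan (k * τ)) ^ 2 =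
        k ^ 2 * (1 + τ ^ 2) / (1 + k ^ 2 * τ ^ 2) := by
      rw [sin_pi_div_two_sub, hmdef, sq_sqrt (by linarith), cos_arctan, div_pow, sq_sqrt hp.le,
        mul_pow]
      field_simp
      ring
    rw [h3]
    refine (pow_left_inj₀ ?_ (by positivity) two_ne_zero).1 ?_
    · simp only [mul_neg, neg_neg]; positivity
    · simp only [mul_neg, neg_neg, mul_one, mul_pow, div_pow, one_pow]
      rw [sq_sqrt (by positivity), sq_sqrt (by positivity)]
      field_simp

/-! ### Identification of the modulus -/

section RealBranch

variable {F : ℂ → ℂ} {V : Set ℂ} {b p : ℝ}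

lemma real_branch (hV : IsOpen V) (hF : DifferentiableOn ℂ F V) (hreal : ∀ x : ℝ, (F x).im = 0)
    {x : ℝ} (hx : (x : ℂ) ∈ V) :
    F x = ((F x).re : ℂ) ∧ deriv F x = ((deriv F x).re : ℂ) ∧
      HasDerivAt (fun y : ℝ => (F y).re) (deriv F x).re x := by
  have hd : HasDerivAt F (deriv F x) x := (hF.differentiableAt (hV.mem_nhds hx)).hasDerivAt
  have heq : ∀ y : ℝ, F y = ((F y).re : ℂ) := fun y => Complex.ext (by simp) (by simp [hreal])
  have h1 := hd.real_of_complex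
  refine ⟨heq x, ?_, h1⟩
  have h2 := h1.ofReal_comp
  simp only [← heq] at h2
  exact hd.comp_ofReal.unique h2

/-- On the axis the derivative is real, continuous and nonzero, so it keeps its positive sign from
0. Without this the differential equation determines s' only up to sign. -/
lemma real_branch_deriv_pos (hV : IsOpen V) (hF : DifferentiableOn ℂ F V)
    (hreal : ∀ x : ℝ, (F x).im = 0) (hsub : ∀ x ∈ Ico 0 b, (x : ℂ) ∈ V) (hp : 0 < p)
    (hd0 : deriv F 0 = p) (hne : ∀ x ∈ Ico 0 b, deriv F x ≠ 0) :
    ∀ x ∈ Ico 0 b, 0 < (deriv F x).re := by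
  intro x hx
  by_contra hneg
  rw [not_lt] at hneg
  have hsub' : ∀ y ∈ Icc 0 x, y ∈ Ico 0 b := fun y hy => ⟨hy.1, hy.2.trans_lt hx.2⟩
  have hcont : ContinuousOn (fun y : ℝ => (deriv F y).re) (Icc 0 x) :=
    Complex.continuous_re.comp_continuousOn ((hF.deriv hV).continuousOn.comp
      Complex.continuous_ofReal.continuousOn fun y hy => hsub y (hsub' y hy))
  obtain ⟨y, hy, hy0⟩ := intermediate_value_Icc' hx.1 hcont
    (show (0 : ℝ) ∈ Icc _ _ from ⟨hneg, by simp [hd0, hp.le]⟩)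
  have h1 := (real_branch hV hF hreal (hsub y (hsub' y hy))).2.1
  simp only at hy0
  rw [hy0] at h1
  exact hne y (hsub' y hy) (by simpa using h1)

end RealBranch

namespace IsEllipseMap

variable {a : ℝ} {Φ : ℂ → ℂ}

lemma ofReal_mem_ellipse_of_mem_Icc (ha : 1 < a) {x : ℝ} (hx : x ∈ Icc 0 (focus a)) :
    (x : ℂ) ∈ ellipse a :=
  ofReal_mem_ellipse ha (by rw [abs_of_nonneg hx.1]; exact hx.2)

/-- The conformal map, restricted to the imaginary axis and rotated to be real there. -/
def rotated (Φ : ℂ → ℂ) (z : ℂ) : ℂ := -Complex.I * Φ (Complex.I * z)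

lemma I_mul_mem_ellipse {y : ℝ} (hy : y ^ 2 < 1) : Complex.I * y ∈ ellipse a := by
  simp [ellipse, hy]

lemma preimage_strip : IsOpen ((fun z => Complex.I * z) ⁻¹' strip) :=
  isOpen_strip.preimage (by fun_prop)

lemma rotated_differentiableOn (h : IsEllipseMap a Φ) :
    DifferentiableOn ℂ (rotated Φ) ((fun z => Complex.I * z) ⁻¹' strip) :=
  (DifferentiableOn.comp (g := Φ) (f := fun z => Complex.I * z) h.differentiableOn (by fun_prop)
    fun _ hz => hz).const_mul (-Complex.I)

lemma deriv_rotated (h : IsEllipseMap a Φ) {z : ℂ} (hz : Complex.I * z ∈ strip) :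
    deriv (rotated Φ) z = deriv Φ (Complex.I * z) := by
  have h1 : HasDerivAt Φ (deriv Φ (Complex.I * z)) (Complex.I * z) :=
    (h.analyticAt hz).differentiableAt.hasDerivAt
  have h2 := (h1.comp z ((hasDerivAt_id z).const_mul Complex.I)).const_mul (-Complex.I)
  refine h2.deriv.trans ?_
  linear_combination (-deriv Φ (Complex.I * z)) * Complex.I_sq

lemma rotated_im (h : IsEllipseMap a Φ) (y : ℝ) : (rotated Φ y).im = 0 := by
  have h1 := h.map_conj (Complex.I * y)
  rw [map_mul, Complex.conj_I, Complex.conj_ofReal, neg_mul, h.odd] at h1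
  have h2 := congrArg Complex.re h1
  simp only [Complex.neg_re, Complex.conj_re] at h2
  simp [rotated]
  linarith

lemma I_mul_mem_strip {y : ℝ} (hy : |y| < 2) : Complex.I * y ∈ strip := by
  simpa [strip] using hy

lemma focalValue_pos (ha : 1 < a) (h : IsEllipseMap a Φ) : 0 < focalValue a Φ := by
  obtain ⟨p, hp, hdp⟩ := h.deriv_zero
  have hsub : ∀ x ∈ Icc 0 (focus a), (x : ℂ) ∈ strip := fun x hx =>
    ellipse_subset_strip a (ofReal_mem_ellipse_of_mem_Icc ha hx)
  have hb := fun x (hx : x ∈ Icc 0 (focus a)) =>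
    (real_branch isOpen_strip h.differentiableOn h.im_ofReal (hsub x hx)).2.2
  have hmono := strictMonoOn_of_hasDerivAt_pos (fun x hx => (hb x hx).continuousAt.continuousWithinAt)
    (fun x hx => hb x (Ico_subset_Icc_self hx))
    (real_branch_deriv_pos isOpen_strip h.differentiableOn h.im_ofReal
      (fun x hx => hsub x (Ico_subset_Icc_self hx)) hp hdp
      fun x hx => h.deriv_ne_zero ha (ofReal_mem_ellipse_of_mem_Icc ha (Ico_subset_Icc_self hx)))
  have := hmono ⟨le_rfl, (focus_pos ha).le⟩ ⟨(focus_pos ha).le, le_rfl⟩ (focus_pos ha)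
  simpa [h.apply_zero, focalValue] using this

section Ode

variable {r : ℝ}

lemma ode_const_pos (ha : 1 < a) (h : IsEllipseMap a Φ)
    (hode : ∀ z ∈ ellipse a, deriv Φ z ^ 2 * ((focus a : ℂ) ^ 2 - z ^ 2) =
      r * (((focalValue a Φ : ℂ) ^ 2 - Φ z ^ 2) * (1 - (focalValue a Φ : ℂ) ^ 2 * Φ z ^ 2))) :
    0 < r := by
  obtain ⟨p, hp, hdp⟩ := h.deriv_zero
  have h0 := hode 0 (zero_mem_ellipse a)
  rw [hdp, h.apply_zero] at h0
  simp only [zero_pow two_ne_zero, sub_zero, mul_zero, mul_one] at h0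
  have h1 : p ^ 2 * focus a ^ 2 = r * focalValue a Φ ^ 2 := by exact_mod_cast h0
  have h2 : 0 < r * focalValue a Φ ^ 2 := by
    rw [← h1]
    have := focus_pos ha
    positivity
  exact pos_of_mul_pos_left h2 (sq_nonneg _)

/-- On [0, c] the map Φ increases from 0 to σ. The substitution Φ = σ sin φ, x = c sin ψ turns the
equation into the elliptic integrand of modulus σ² against √r dψ. -/
lemma ellipticK_focalValue (ha : 1 < a) (h : IsEllipseMap a Φ)
    (hode : ∀ z ∈ ellipse a, deriv Φ z ^ 2 * ((focus a : ℂ) ^ 2 - z ^ 2) =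
      r * (((focalValue a Φ : ℂ) ^ 2 - Φ z ^ 2) * (1 - (focalValue a Φ : ℂ) ^ 2 * Φ z ^ 2))) :
    ellipticK (focalValue a Φ ^ 2) = √r * (π / 2) := by
  obtain ⟨p, hp, hdp⟩ := h.deriv_zero
  have hmem : ∀ x ∈ Icc 0 (focus a), (x : ℂ) ∈ ellipse a := fun x hx =>
    ofReal_mem_ellipse_of_mem_Icc ha hx
  have hb := fun x (hx : x ∈ Icc 0 (focus a)) =>
    real_branch isOpen_strip h.differentiableOn h.im_ofReal (ellipse_subset_strip a (hmem x hx))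
  refine ellipticK_of_ode (s := fun x => (Φ x).re) (s' := fun x => (deriv Φ x).re) (focus_pos ha)
    (h.focalValue_pos ha) (h.focalValue_sq_lt_one ha) (h.ode_const_pos ha hode).le
    (fun x hx => (hb x hx).2.2.continuousAt.continuousWithinAt)
    (fun x hx => (hb x (Ico_subset_Icc_self hx)).2.2)
    (real_branch_deriv_pos isOpen_strip h.differentiableOn h.im_ofReal
      (fun x hx => ellipse_subset_strip a (hmem x (Ico_subset_Icc_self hx))) hp hdp
      fun x hx => h.deriv_ne_zero ha (hmem x (Ico_subset_Icc_self hx)))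
    (by simp [h.apply_zero]) rfl fun x hx => ?_
  have hx' := Ico_subset_Icc_self hx
  have h1 := hode x (hmem x hx')
  rw [(hb x hx').1, (hb x hx').2.1] at h1
  exact_mod_cast h1

/-- On the imaginary axis Φ(iy) = i t(y), which flips the signs of the squares in the equation. The
integral runs from t = 0 to t(1) = 1, that is up to the angle arctan(1/σ), which is half of the
complementary integral. -/
lemma ellipticK_compl_focalValue (ha : 1 < a) (h : IsEllipseMap a Φ)
    (hode : ∀ z ∈ ellipse a, deriv Φ z ^ 2 * ((focus a : ℂ) ^ 2 - z ^ 2) =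
      r * (((focalValue a Φ : ℂ) ^ 2 - Φ z ^ 2) * (1 - (focalValue a Φ : ℂ) ^ 2 * Φ z ^ 2))) :
    ellipticK √(1 - (focalValue a Φ ^ 2) ^ 2) = 2 * (√r * arsinh (1 / focus a)) := by
  obtain ⟨p, hp, hdp⟩ := h.deriv_zero
  have hstrip : ∀ x ∈ Icc (0 : ℝ) 1, Complex.I * x ∈ strip := fun x hx =>
    I_mul_mem_strip (by rw [abs_of_nonneg hx.1]; linarith [hx.2])
  have hmem : ∀ x ∈ Ico (0 : ℝ) 1, Complex.I * x ∈ ellipse a := fun x hx =>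
    I_mul_mem_ellipse (by nlinarith [hx.1, hx.2])
  have hb := fun x (hx : x ∈ Icc (0 : ℝ) 1) =>
    real_branch preimage_strip h.rotated_differentiableOn h.rotated_im (hstrip x hx)
  have hdpos : ∀ x ∈ Ico (0 : ℝ) 1, 0 < (deriv (rotated Φ) x).re :=
    real_branch_deriv_pos preimage_strip h.rotated_differentiableOn h.rotated_im
      (fun x hx => hstrip x (Ico_subset_Icc_self hx)) hp
      (by rw [h.deriv_rotated (by simp [zero_mem_strip]), mul_zero, hdp])
      (fun x hx => by
        rw [h.deriv_rotated (hstrip x (Ico_subset_Icc_self hx))]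
        exact h.deriv_ne_zero ha (hmem x hx))
  have hcont : ContinuousOn (fun x : ℝ => (rotated Φ x).re) (Icc 0 1) :=
    fun x hx => (hb x hx).2.2.continuousAt.continuousWithinAt
  have hd : ∀ x ∈ Ico (0 : ℝ) 1, HasDerivAt (fun x : ℝ => (rotated Φ x).re)
      (deriv (rotated Φ) x).re x := fun x hx => (hb x (Ico_subset_Icc_self hx)).2.2
  have h0 : (rotated Φ (0 : ℝ)).re = 0 := by simp [rotated, h.apply_zero]
  -- The point i lies on the boundary ellipse, so the value has modulus 1; it is real, and positive
  -- by monotonicity.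
  have h1 : (rotated Φ (1 : ℝ)).re = 1 := by
    have hlt := strictMonoOn_of_hasDerivAt_pos hcont hd hdpos ⟨le_rfl, one_pos.le⟩
      ⟨one_pos.le, le_rfl⟩ one_pos
    simp only [h0] at hlt
    have hn : ‖rotated Φ (1 : ℝ)‖ = 1 := by
      have hI : boundaryPoint a (π / 2) = Complex.I := by
        apply Complex.ext <;> simp [boundaryPoint]
      have := h.norm_boundary (π / 2)
      rw [hI] at this
      simp [rotated, this]
    rw [(hb 1 ⟨one_pos.le, le_rfl⟩).1, Complex.norm_real, Real.norm_of_nonneg hlt.le] at hn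
    exact hn
  have hσ := h.focalValue_pos ha
  have hσ1 := h.focalValue_sq_lt_one ha
  have key := ellipticF_arctan_of_ode (t := fun x => (rotated Φ x).re)
    (t' := fun x => (deriv (rotated Φ) x).re) (focus_pos ha) hσ hσ1 one_pos.le
    (h.ode_const_pos ha hode).le hcont hd hdpos h0 (fun x hx => by
      have hx' := Ico_subset_Icc_self hx
      have e1 := hode (Complex.I * x) (hmem x hx)
      have e2 : Φ (Complex.I * x) = Complex.I * ((rotated Φ x).re : ℂ) := by
        rw [← (hb x hx').1, rotated]
        linear_combination Φ (Complex.I * x) * Complex.I_sq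
      rw [← h.deriv_rotated (hstrip x hx'), e2, (hb x hx').2.1] at e1
      simp only [mul_pow, Complex.I_sq] at e1
      have e3 : ((deriv (rotated Φ) x).re : ℂ) ^ 2 * ((focus a : ℂ) ^ 2 + (x : ℂ) ^ 2) =
          r * (((focalValue a Φ : ℂ) ^ 2 + ((rotated Φ x).re : ℂ) ^ 2) *
            (1 + (focalValue a Φ : ℂ) ^ 2 * ((rotated Φ x).re : ℂ) ^ 2)) := by
        linear_combination e1
      exact_mod_cast e3)
  simp only [h1] at key
  rw [← two_mul_ellipticF_half hσ hσ1, key]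

/-- The square of the value of the conformal map at the focus is the elliptic modulus. -/
lemma isModulus_focalValue (ha : 1 < a) (h : IsEllipseMap a Φ)
    (hode : ∀ z ∈ ellipse a, deriv Φ z ^ 2 * ((focus a : ℂ) ^ 2 - z ^ 2) =
      r * (((focalValue a Φ : ℂ) ^ 2 - Φ z ^ 2) * (1 - (focalValue a Φ : ℂ) ^ 2 * Φ z ^ 2))) :
    IsModulus a (focalValue a Φ ^ 2) := by
  have hr := sqrt_pos.2 (h.ode_const_pos ha hode)
  have hc := focus_pos ha
  refine ⟨⟨pow_pos (h.focalValue_pos ha) 2, h.focalValue_sq_lt_one ha⟩, ?_⟩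
  -- If sinh x = 1/c then cosh x = a/c, and the duplication formula gives sinh 2x = 2a/c².
  have hsinh : 2 * a / (a ^ 2 - 1) = Real.sinh (2 * arsinh (1 / focus a)) := by
    have h1 : √(1 + (1 / focus a) ^ 2) = a / focus a := by
      rw [sqrt_eq_iff_mul_self_eq (by positivity) (by positivity)]
      field_simp
      linarith [focus_sq ha]
    rw [Real.sinh_two_mul, sinh_arsinh, cosh_arsinh, h1, ← focus_sq ha]
    field_simp
  rw [quotientG, h.ellipticK_focalValue ha hode, h.ellipticK_compl_focalValue ha hode, hsinh,
    arsinh_sinh]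
  field_simp

/-- The third derivative of the conformal map at the centre. -/
lemma third_deriv (ha : 1 < a) (h : IsEllipseMap a Φ)
    (hode : ∀ z ∈ ellipse a, deriv Φ z ^ 2 * ((focus a : ℂ) ^ 2 - z ^ 2) =
      r * (((focalValue a Φ : ℂ) ^ 2 - Φ z ^ 2) * (1 - (focalValue a Φ : ℂ) ^ 2 * Φ z ^ 2))) :
    iteratedDeriv 3 Φ 0 * (focus a : ℂ) ^ 2 =
      (1 - r * (1 + ((focalValue a Φ : ℂ) ^ 2) ^ 2)) * deriv Φ 0 := by
  set κ : ℂ := (focalValue a Φ : ℂ) ^ 2 with hκ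
  set c : ℂ := (focus a : ℂ) with hc
  have hnhds : ∀ z ∈ ellipse a, ellipse a ∈ 𝓝 z := fun z hz => (isOpen_ellipse a).mem_nhds hz
  have hΦ : ∀ z ∈ ellipse a, HasDerivAt Φ (deriv Φ z) z := fun z hz =>
    (h.analyticAt (ellipse_subset_strip a hz)).differentiableAt.hasDerivAt
  have hΦ' : ∀ z ∈ ellipse a, HasDerivAt (deriv Φ) (deriv (deriv Φ) z) z := fun z hz =>
    (h.analyticAt (ellipse_subset_strip a hz)).deriv.differentiableAt.hasDerivAt
  have h2 : ∀ z ∈ ellipse a, deriv (deriv Φ) z * (c ^ 2 - z ^ 2) - z * deriv Φ z =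
      r * (Φ z * (2 * κ * Φ z ^ 2 - (1 + κ ^ 2))) := by
    intro z hz
    have hl := ((hΦ' z hz).fun_pow 2).fun_mul (((hasDerivAt_id z).fun_pow 2).const_sub (c ^ 2))
    have hr := ((((hΦ z hz).fun_pow 2).const_sub κ).fun_mul
      ((((hΦ z hz).fun_pow 2).const_mul κ).const_sub 1)).const_mul (r : ℂ)
    have hev : (fun w => deriv Φ w ^ 2 * (c ^ 2 - id w ^ 2)) =ᶠ[𝓝 z]
        fun w => (r : ℂ) * ((κ - Φ w ^ 2) * (1 - κ * Φ w ^ 2)) := by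
      filter_upwards [hnhds z hz] with w hw using hode w hw
    have heq := hl.unique (hr.congr_of_eventuallyEq hev)
    -- The differentiated first-order equation carries the common factor 2Φ', which is nonzero by
    -- injectivity.
    refine mul_left_cancel₀ (mul_ne_zero two_ne_zero (h.deriv_ne_zero ha hz)) ?_
    simp only [id, Nat.cast_ofNat, Nat.add_one_sub_one, pow_one, mul_one] at heq
    linear_combination heq
  have h0 := zero_mem_ellipse a
  have hΦ'' : HasDerivAt (deriv (deriv Φ)) (deriv (deriv (deriv Φ)) 0) 0 :=
    (h.analyticAt zero_mem_strip).deriv.deriv.differentiableAt.hasDerivAt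
  have hl := (hΦ''.fun_mul (((hasDerivAt_id (0 : ℂ)).fun_pow 2).const_sub (c ^ 2))).fun_sub
    ((hasDerivAt_id (0 : ℂ)).fun_mul (hΦ' 0 h0))
  have hr := ((hΦ 0 h0).fun_mul ((((hΦ 0 h0).fun_pow 2).const_mul (2 * κ)).sub_const
    (1 + κ ^ 2))).const_mul (r : ℂ)
  have hev : (fun w => deriv (deriv Φ) w * (c ^ 2 - id w ^ 2) - id w * deriv Φ w) =ᶠ[𝓝 0]
      fun w => (r : ℂ) * (Φ w * (2 * κ * Φ w ^ 2 - (1 + κ ^ 2))) := by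
    filter_upwards [hnhds 0 h0] with w hw using h2 w hw
  have heq := hl.unique (hr.congr_of_eventuallyEq hev)
  rw [h.apply_zero] at heq
  simp only [id, Nat.cast_ofNat, Nat.add_one_sub_one, pow_one, mul_one] at heq
  rw [iteratedDeriv_succ, iteratedDeriv_succ, iteratedDeriv_one]
  linear_combination heq

end Ode

/-- The conformal invariant of the ellipse at its centre. -/
lemma norm_third_deriv_div (ha : 1 < a) (h : IsEllipseMap a Φ) :
    ‖iteratedDeriv 3 Φ 0 / deriv Φ 0 ^ 3‖ = 2 * halfRatio (modulus a) := by
  obtain ⟨r, hode⟩ := h.exists_ode ha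
  have hmod := h.isModulus_focalValue ha hode
  have hk : focalValue a Φ ^ 2 = modulus a := isModulus_unique hmod (isModulus_modulus ha)
  have hr := h.ode_const_pos ha hode
  have hK := h.ellipticK_focalValue ha hode
  have h3 := h.third_deriv ha hode
  obtain ⟨p, hp, hdp⟩ := h.deriv_zero
  have hode0 := hode 0 (zero_mem_ellipse a)
  rw [hdp, h.apply_zero] at hode0
  simp only [zero_pow two_ne_zero, sub_zero, mul_zero, mul_one] at hode0
  have h1 : p ^ 2 * focus a ^ 2 = r * focalValue a Φ ^ 2 := by exact_mod_cast hode0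
  have hc := focus_pos ha
  rw [hk] at h1 hK
  have hk2 : (focalValue a Φ : ℂ) ^ 2 = (modulus a : ℂ) := by exact_mod_cast congrArg Complex.ofReal hk
  rw [hk2, hdp] at h3
  have hkm := modulus_mem ha
  have hk0 := hkm.1
  have hval : iteratedDeriv 3 Φ 0 / deriv Φ 0 ^ 3 = ((-(2 * halfRatio (modulus a)) : ℝ) : ℂ) := by
    have hpc : (p : ℂ) ≠ 0 := by exact_mod_cast hp.ne'
    have hcc : (focus a : ℂ) ≠ 0 := by exact_mod_cast hc.ne'
    have hratio : (π / (2 * ellipticK (modulus a))) ^ 2 = 1 / r := by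
      have hπ := pi_pos
      have hs := sqrt_pos.2 hr
      rw [hK, show π / (2 * (√r * (π / 2))) = 1 / √r by field_simp, div_pow, one_pow,
        sq_sqrt hr.le]
    have hreal : (1 - r * (1 + modulus a ^ 2)) * p / (focus a ^ 2 * p ^ 3) =
        -(2 * halfRatio (modulus a)) := by
      have e1 : focus a ^ 2 * p ^ 3 = r * modulus a * p := by linear_combination p * h1
      rw [e1, halfRatio, hratio]
      field_simp
      ring
    rw [← hreal, hdp]
    have h3' : iteratedDeriv 3 Φ 0 =
        (1 - r * (1 + (modulus a : ℂ) ^ 2)) * p / (focus a : ℂ) ^ 2 := by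
      rw [eq_div_iff (pow_ne_zero 2 hcc), h3]
    rw [h3']
    push_cast
    field_simp
  rw [hval, Complex.norm_real, norm_neg, Real.norm_of_nonneg]
  have := halfRatio_pos hkm
  linarith

end IsEllipseMap

/-! ### The Robin function -/

lemma hasFDerivAt_log_norm_of_zero {G : ℂ → ℂ} {z : ℂ}
    (hG : HasFDerivAt G (0 : ℂ →L[ℝ] ℂ) z) (hz : G z ≠ 0) :
    HasFDerivAt (fun x => Real.log ‖G x‖) (0 : ℂ →L[ℝ] ℝ) z := by
  have h1 : DifferentiableAt ℝ (fun w : ℂ => Real.log ‖w‖) (G z) :=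
    (differentiableAt_id.norm ℝ hz).log (norm_ne_zero_iff.2 hz)
  simpa [Function.comp_def] using h1.hasFDerivAt.comp z hG

lemma norm_one_sub_conj_mul {u v : ℂ} (hu : ‖u‖ = 1) :
    ‖1 - starRingEnd ℂ v * u‖ = ‖u - v‖ := by
  have huu : u * starRingEnd ℂ u = 1 := by
    rw [Complex.mul_conj, Complex.normSq_eq_norm_sq, hu]; norm_num
  have h : 1 - starRingEnd ℂ v * u = u * starRingEnd ℂ (u - v) := by
    rw [map_sub]; linear_combination -huu
  rw [h, norm_mul, hu, one_mul, Complex.norm_conj]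

lemma one_sub_conj_mul_ne_zero {u v : ℂ} (hu : ‖u‖ ≤ 1) (hv : ‖v‖ < 1) :
    1 - starRingEnd ℂ v * u ≠ 0 := by
  intro h
  have h1 : ‖starRingEnd ℂ v * u‖ = 1 := by rw [← sub_eq_zero.1 h, norm_one]
  rw [norm_mul, Complex.norm_conj] at h1
  nlinarith [norm_nonneg u, norm_nonneg v]

namespace IsEllipseMap

variable {a : ℝ} {Φ : ℂ → ℂ}

/-- The regular part of the Green function, in terms of the conformal map onto the disc. -/
def greenRegularPart (Φ : ℂ → ℂ) (z w : ℂ) : ℝ :=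
  Real.log ‖dslope Φ w z‖ - Real.log ‖1 - starRingEnd ℂ (Φ w) * Φ z‖

/-- Adding log|z - w| turns the difference quotient into log|Φ(z) - Φ(w)|, giving the Green function
of the disc pulled back by Φ. It vanishes on the boundary because |1 - v̄u| = |u - v| for |u| = 1.
-/
lemma isGreenRegularPart (ha : 1 < a) (h : IsEllipseMap a Φ) :
    IsGreenRegularPart (ellipse a) (greenRegularPart Φ) := by
  intro w hw
  have hws : strip ∈ 𝓝 w := isOpen_strip.mem_nhds (ellipse_subset_strip a hw)
  have hds : DifferentiableOn ℂ (dslope Φ w) strip :=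
    (Complex.differentiableOn_dslope hws).2 h.differentiableOn
  have hdd : DifferentiableOn ℂ (fun z => 1 - starRingEnd ℂ (Φ w) * Φ z) strip :=
    (differentiableOn_const _).sub (h.differentiableOn.const_mul _)
  constructor
  · intro z hz
    have hzs := isOpen_strip.mem_nhds (ellipse_subset_strip a hz)
    exact ((hds.analyticAt hzs).harmonicAt_log_norm
      (h.dslope_ne_zero ha hw (subset_closure hz))).sub
      ((hdd.analyticAt hzs).harmonicAt_log_norm
        (one_sub_conj_mul_ne_zero (h.norm_lt_one ha hz).le (h.norm_lt_one ha hw)))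
  · intro ζ hζ
    have hζc := frontier_subset_closure hζ
    have hζs := isOpen_strip.mem_nhds (closure_ellipse_subset_strip a hζc)
    have hζw : ζ ≠ w := by
      rintro rfl
      rw [(isOpen_ellipse a).frontier_eq] at hζ
      exact hζ.2 hw
    have h0 : ‖ζ - w‖ ≠ 0 := norm_ne_zero_iff.2 (sub_ne_zero.2 hζw)
    have h1 : ‖dslope Φ w ζ‖ ≠ 0 := norm_ne_zero_iff.2 (h.dslope_ne_zero ha hw hζc)
    have h2 : ‖1 - starRingEnd ℂ (Φ w) * Φ ζ‖ ≠ 0 := norm_ne_zero_iff.2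
      (one_sub_conj_mul_ne_zero (h.norm_le_one ha hζc) (h.norm_lt_one ha hw))
    have hval : Real.log ‖ζ - w‖ + greenRegularPart Φ ζ w = 0 := by
      rw [greenRegularPart, ← add_sub_assoc, ← Real.log_mul h0 h1,
        norm_one_sub_conj_mul (h.norm_frontier ha hζ), mul_comm, ← norm_sub_eq_dslope, sub_self]
    have hcont : ContinuousAt (fun z => Real.log ‖z - w‖ + greenRegularPart Φ z w) ζ := by
      refine ContinuousAt.add (ContinuousAt.log (by fun_prop) h0)
        (ContinuousAt.sub (ContinuousAt.log ?_ h1) (ContinuousAt.log ?_ h2))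
      · exact (hds.continuousOn.continuousAt hζs).norm
      · exact (hdd.continuousOn.continuousAt hζs).norm
    have := hcont.tendsto
    rw [hval] at this
    exact this.mono_left nhdsWithin_le_nhds

/-- Both functions under the logarithms have zero derivative at 0: Φ' because Φ''(0) = 0, and 1 -
|Φ|² because Φ(0) = 0. -/
lemma isRobinCritical (ha : 1 < a) (h : IsEllipseMap a Φ) : IsRobinCritical (ellipse a) 0 := by
  have h0 := zero_mem_ellipse a
  refine ⟨h0, fun z => greenRegularPart Φ z z,
    ⟨greenRegularPart Φ, h.isGreenRegularPart ha, fun _ _ => rfl⟩, ?_⟩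
  have han := h.analyticAt zero_mem_strip
  have h1 : HasFDerivAt (deriv Φ) (0 : ℂ →L[ℝ] ℂ) 0 := by
    have h2 := han.deriv.differentiableAt.hasDerivAt
    rw [h.deriv_deriv_zero] at h2
    have h3 := h2.hasFDerivAt.restrictScalars ℝ
    refine h3.congr_fderiv ?_
    ext; simp
  have h4 : HasFDerivAt (fun z => 1 - starRingEnd ℂ (Φ z) * Φ z) (0 : ℂ →L[ℝ] ℂ) 0 := by
    have h5 := han.differentiableAt.hasDerivAt.hasFDerivAt.restrictScalars ℝ
    have h6 := Complex.conjCLE.toContinuousLinearMap.hasFDerivAt.comp (0 : ℂ) h5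
    have h7 := (h6.mul h5).const_sub 1
    refine h7.congr_fderiv ?_
    ext; simp [h.apply_zero]
  have h8 := (hasFDerivAt_log_norm_of_zero h1 (h.deriv_ne_zero ha h0)).sub
    (hasFDerivAt_log_norm_of_zero h4 (by simp [h.apply_zero]))
  simp only [sub_zero] at h8
  refine h8.congr_of_eventuallyEq (Eventually.of_forall fun z => ?_)
  simp [greenRegularPart, dslope_same]

lemma nonDegenerate (ha : 1 < a) (h : IsEllipseMap a Φ)
    (hg : ∀ n : ℕ, 2 ≤ n → g (modulus a) ≠ n) : NonDegenerate (ellipse a) 0 := by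
  have h0 := zero_mem_ellipse a
  have hconf := h.isConformalOntoDisc ha
  refine ⟨h.isRobinCritical ha, ⟨Φ, hconf, h.apply_zero⟩, fun Ψ hΨ hΨ0 => ?_⟩
  obtain ⟨c, hc, hΨc⟩ := conformal_unique (isOpen_ellipse a) h0 hconf hΨ h.apply_zero hΨ0
  have hev : Ψ =ᶠ[𝓝 0] fun z => c * Φ z := by
    filter_upwards [(isOpen_ellipse a).mem_nhds h0] with z hz using hΨc z hz
  have h1 : deriv Ψ 0 = c * deriv Φ 0 := by
    rw [hev.deriv_eq, deriv_const_mul_field]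
  have h3 : iteratedDeriv 3 Ψ 0 = c * iteratedDeriv 3 Φ 0 := by
    rw [hev.iteratedDeriv_eq, iteratedDeriv_const_mul_field]
  have hnorm : ‖iteratedDeriv 3 Ψ 0 / deriv Ψ 0 ^ 3‖ = ‖iteratedDeriv 3 Φ 0 / deriv Φ 0 ^ 3‖ := by
    rw [h1, h3, norm_div, norm_div, mul_pow, norm_mul, norm_mul, norm_pow c, hc, one_pow, one_mul,
      one_mul]
  rw [hnorm, h.norm_third_deriv_div ha]
  exact two_mul_halfRatio_notMem (modulus_mem ha) hg

end IsEllipseMap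

end VortexEllipse

end

theorem proposition5p1 :
    (∀ a : ℝ, 1 < a → VortexEllipse.IsModulus a (VortexEllipse.modulus a) ∧
      ∀ k : ℝ, VortexEllipse.IsModulus a k → k = VortexEllipse.modulus a) ∧
    (∀ k ∈ Ioo (0 : ℝ) 1, 0 < VortexEllipse.radicand k) ∧
    ContinuousOn VortexEllipse.g (Ico 0 1) ∧
    StrictMonoOn VortexEllipse.g (Ico 0 1) ∧
    VortexEllipse.g 0 = 1 ∧
    Tendsto VortexEllipse.g (𝓝[<] 1) atTop ∧
    (∀ n : ℕ, 1 ≤ n → ∃! k : ℝ, k ∈ Ico (0 : ℝ) 1 ∧ VortexEllipse.g k = n) ∧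
    ∃ α : ℕ → ℝ,
      (∀ n : ℕ, 2 ≤ n → 1 < α n ∧ VortexEllipse.g (VortexEllipse.modulus (α n)) = n ∧
        ∀ a : ℝ, 1 < a → VortexEllipse.g (VortexEllipse.modulus a) = n → a = α n) ∧
      ∀ a : ℝ, 1 < a → (∀ n : ℕ, 2 ≤ n → a ≠ α n) →
        VortexEllipse.NonDegenerate (VortexEllipse.ellipse a) 0 := by
  refine ⟨fun a ha => ⟨VortexEllipse.isModulus_modulus ha, fun k hk =>
      VortexEllipse.isModulus_unique hk (VortexEllipse.isModulus_modulus ha)⟩,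
    fun k hk => VortexEllipse.radicand_pos hk, VortexEllipse.g_continuousOn,
    VortexEllipse.g_strictMonoOn, VortexEllipse.g_zero, VortexEllipse.tendsto_g_one,
    fun n hn => VortexEllipse.existsUnique_g_eq (by exact_mod_cast hn), ?_⟩
  have hex : ∀ n : ℕ, ∃ α : ℝ, 2 ≤ n → 1 < α ∧ VortexEllipse.g (VortexEllipse.modulus α) = n ∧
      ∀ a : ℝ, 1 < a → VortexEllipse.g (VortexEllipse.modulus a) = n → a = α := fun n => by
    by_cases hn : 2 ≤ n
    · have hn1 : (1 : ℝ) < n := by exact_mod_cast hn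
      obtain ⟨α, hα⟩ := VortexEllipse.existsUnique_g_modulus_eq hn1
      exact ⟨α, fun _ => hα⟩
    · exact ⟨0, fun h => absurd h hn⟩
  choose α hα using hex
  refine ⟨α, hα, fun a ha hne => ?_⟩
  obtain ⟨Φ, hΦ⟩ := VortexEllipse.exists_isEllipseMap ha
  exact hΦ.nonDegenerate ha fun n hn hgn => hne n hn ((hα n hn).2.2 a ha hgn)
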